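/- Let $(M,\omega)$ be a (Hausdorff, second countable, finite-dimensional, smooth) symplectic manifold with a Riemannian metric $g_M$, and let $G$ be a Lie group acting smoothly on $M$ by isometries of $g_M$. Suppose that the action is Hamiltonian, i.e. it preserves $\omega$ and there is a smooth momentum mapping $\mu:M\to\mathfrak g^*$ with $d\langle\mu,\xi\rangle=\omega(\xi_M,\cdot)$ for all $\xi\in\mathfrak g$, where $\xi_M(x)=\frac{d}{dt}\big|_{t=0}\exp(t\xi)\cdot x$, and that $\mu$ is $\mathrm{Ad}^*$-equivariant, i.e. $\langle\mu(a\cdot x),\xi\rangle=\langle\mu(x),\mathrm{Ad}_{a^{-1}}\xi\rangle$ for all $a\in G$, $x\in M$, $\xi\in\mathfrak g$. Let $\beta\in\mathfrak g^*$ be a regular value of $\mu$ (i.e. $d\mu_x$ is surjective for every $x\in\mu^{-1}(\beta)$), let $G_\beta=\{a\in G:\beta\circ\mathrm{Ad}_{a^{-1}}=\beta\}$ be its isotropy subgroup, and suppose that $G_\beta$ acts freely and properly on $\mu^{-1}(\beta)$. Then $\mu^{-1}(\beta)$, with the subspace topology, has a smooth structure making it an embedded submanifold of $M$, with inclusion $i:\mu^{-1}(\beta)\to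 M$, and the reduced space $\mu^{-1}(\beta)/G_\beta$, with the quotient topology, has a smooth structure making it a Hausdorff, second countable smooth manifold for which the projection $\pi_\beta:\mu^{-1}(\beta)\to\mu^{-1}(\beta)/G_\beta$ is a smooth submersion. Moreover, for these structures, $i^*g_M$ is a Riemannian metric on $\mu^{-1}(\beta)$ and there is a Riemannian metric $g_\beta$ on $\mu^{-1}(\beta)/G_\beta$ such that $\pi_\beta:(\mu^{-1}(\beta),i^*g_M)\to(\mu^{-1}(\beta)/G_\beta,g_\beta)$ is a Riemannian submersion: $\pi_\beta$ is smooth, every differential $(d\pi_\beta)_m$ is surjective, and $$(i^*g_M)_m(u,v)=(g_\beta)_{\pi_\beta(m)}\big((d\pi_\beta)_m u,(d\pi_\beta)_m v\big)$$ for all $m\in\mu^{-1}(\beta)$ and all horizontal $u,v\in T_m\mu^{-1}(\beta)$, i.e. all $u,v$ that are $i^*g_M$-orthogonal to $\ker (d\pi_\beta)_m$. -/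

import Mathlib

open scoped Manifold ContDiff

noncomputable section

namespace SymplecticReduction

section Forms

/-- A smooth Riemannian metric on the smooth manifold `M` modelled on `E`. -/
abbrev RiemannianMetricOn (E : Type*) [NormedAddCommGroup E] [NormedSpace ℝ E]
    (M : Type*) [TopologicalSpace M] [ChartedSpace E M] [IsManifold 𝓘(ℝ, E) ∞ M] :=
  Bundle.ContMDiffRiemannianMetric 𝓘(ℝ, E) ∞ E (fun x : M => TangentSpace 𝓘(ℝ, E) x)

/-- A symplectic form on the smooth manifold `M` modelled on `E`: a smooth, alternating,
nondegenerate and closed field of bilinear forms on the tangent spaces. -/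
structure SymplecticForm (E : Type*) [NormedAddCommGroup E] [NormedSpace ℝ E]
    (M : Type*) [TopologicalSpace M] [ChartedSpace E M] [IsManifold 𝓘(ℝ, E) ∞ M] where
  form (x : M) : TangentSpace 𝓘(ℝ, E) x →L[ℝ] TangentSpace 𝓘(ℝ, E) x →L[ℝ] ℝ
  contMDiff : ContMDiff 𝓘(ℝ, E) (𝓘(ℝ, E).prod 𝓘(ℝ, E →L[ℝ] E →L[ℝ] ℝ)) ∞
    (fun x : M => Bundle.TotalSpace.mk' (E →L[ℝ] E →L[ℝ] ℝ) x (form x))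
  alternating (x : M) (v : TangentSpace 𝓘(ℝ, E) x) : form x v v = 0
  nondegenerate (x : M) (v : TangentSpace 𝓘(ℝ, E) x) (hv : ∀ w, form x v w = 0) : v = 0
  /-- `dω = 0`, in the coordinates of each preferred chart `φ`: with
  `ω_φ(z)(a, b) = ω(φ⁻¹ z)(dφ⁻¹ a, dφ⁻¹ b)`, the cyclic sum of the derivatives
  `D_u ω_φ(v, w)` vanishes. -/
  closed (x₀ : M) (y : E) (hy : y ∈ (extChartAt 𝓘(ℝ, E) x₀).target) (u v w : E) :
    let φ := extChartAt 𝓘(ℝ, E) x₀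
    let coord : E → E → E → ℝ := fun a b z =>
      form (φ.symm z) (mfderiv 𝓘(ℝ, E) 𝓘(ℝ, E) φ.symm z a) (mfderiv 𝓘(ℝ, E) 𝓘(ℝ, E) φ.symm z b)
    fderiv ℝ (coord v w) y u + fderiv ℝ (coord w u) y v + fderiv ℝ (coord u v) y w = 0

end Forms

section Submersions

variable {E₁ : Type*} [NormedAddCommGroup E₁] [NormedSpace ℝ E₁]
  {N : Type*} [TopologicalSpace N] [ChartedSpace E₁ N] [IsManifold 𝓘(ℝ, E₁) ∞ N]
  {E₂ : Type*} [NormedAddCommGroup E₂] [NormedSpace ℝ E₂]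
  {B : Type*} [TopologicalSpace B] [ChartedSpace E₂ B] [IsManifold 𝓘(ℝ, E₂) ∞ B]

/-- `h = f^* g` for Riemannian metrics `h` on `N` and `g` on `B` and a map `f : N → B`. -/
def IsPullbackMetric (h : RiemannianMetricOn E₁ N) (g : RiemannianMetricOn E₂ B)
    (f : N → B) : Prop :=
  ∀ (p : N) (u v : TangentSpace 𝓘(ℝ, E₁) p),
    h.inner p u v =
      g.inner (f p) (mfderiv 𝓘(ℝ, E₁) 𝓘(ℝ, E₂) f p u) (mfderiv 𝓘(ℝ, E₁) 𝓘(ℝ, E₂) f p v)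

/-- The tangent vector `u` at `p` is horizontal for `f`: it is orthogonal to the vertical
space `ker (df)_p`. -/
def IsHorizontal (E₂ : Type*) [NormedAddCommGroup E₂] [NormedSpace ℝ E₂]
    {B : Type*} [TopologicalSpace B] [ChartedSpace E₂ B]
    (h : RiemannianMetricOn E₁ N) (f : N → B) (p : N) (u : TangentSpace 𝓘(ℝ, E₁) p) : Prop :=
  ∀ v : TangentSpace 𝓘(ℝ, E₁) p, mfderiv 𝓘(ℝ, E₁) 𝓘(ℝ, E₂) f p v = 0 → h.inner p u v = 0

/-- The smooth map `f : (N, h) → (B, g)` is a Riemannian submersion: its differentials are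
surjective, and they preserve the inner products of horizontal vectors. -/
structure IsRiemannianSubmersion (h : RiemannianMetricOn E₁ N) (g : RiemannianMetricOn E₂ B)
    (f : N → B) : Prop where
  contMDiff : ContMDiff 𝓘(ℝ, E₁) 𝓘(ℝ, E₂) ∞ f
  surjective (p : N) : Function.Surjective (mfderiv 𝓘(ℝ, E₁) 𝓘(ℝ, E₂) f p)
  isometry_horizontal (p : N) (u v : TangentSpace 𝓘(ℝ, E₁) p)
    (hu : IsHorizontal E₂ h f p u) (hv : IsHorizontal E₂ h f p v) :
    h.inner p u v =
      g.inner (f p) (mfderiv 𝓘(ℝ, E₁) 𝓘(ℝ, E₂) f p u) (mfderiv 𝓘(ℝ, E₁) 𝓘(ℝ, E₂) f p v)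

end Submersions

section Coadjoint

variable {F : Type*} [NormedAddCommGroup F] [NormedSpace ℝ F]
  {G : Type*} [TopologicalSpace G] [ChartedSpace F G] [Group G]

/-- The dual of the Lie algebra `T_1 G` of `G`. The tangent space at `1` is the model space `F`
by definition, which provides the (finite-dimensional) topology and smooth structure. -/
abbrev LieDual (F : Type*) [NormedAddCommGroup F] [NormedSpace ℝ F] := F →L[ℝ] ℝ

/-- The adjoint action of `g` on the Lie algebra: the derivative at `1` of `k ↦ g k g⁻¹`. -/
def Ad (g : G) : F →L[ℝ] F :=
  mfderiv 𝓘(ℝ, F) 𝓘(ℝ, F) (fun k : G => g * k * g⁻¹) (1 : G)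

lemma Ad_one : Ad (F := F) (1 : G) = ContinuousLinearMap.id ℝ F := by
  unfold Ad
  have : (fun k : G => (1 : G) * k * (1 : G)⁻¹) = id := by ext k; simp
  rw [this]
  exact mfderiv_id

variable [LieGroup 𝓘(ℝ, F) ∞ G]

lemma mdifferentiableAt_conj (g k : G) :
    MDifferentiableAt 𝓘(ℝ, F) 𝓘(ℝ, F) (fun k : G => g * k * g⁻¹) k := by
  have h : ContMDiff 𝓘(ℝ, F) 𝓘(ℝ, F) ∞ (fun k : G => g * k * g⁻¹) :=
    (contMDiff_const.mul contMDiff_id).mul contMDiff_const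
  exact h.contMDiffAt.mdifferentiableAt (by simp)

lemma Ad_mul (g h : G) : Ad (F := F) (g * h) = (Ad g).comp (Ad h) := by
  have e : (fun k : G => g * h * k * (g * h)⁻¹) =
      (fun k : G => g * k * g⁻¹) ∘ (fun k : G => h * k * h⁻¹) := by
    ext k; simp [mul_assoc]
  have hc := mfderiv_comp (I := 𝓘(ℝ, F)) (I' := 𝓘(ℝ, F)) (I'' := 𝓘(ℝ, F)) (1 : G)
    (mdifferentiableAt_conj (F := F) g (h * 1 * h⁻¹)) (mdifferentiableAt_conj (F := F) h 1)
  rw [← e] at hc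
  have h1 : h * 1 * h⁻¹ = 1 := by simp
  let D : G → F →L[ℝ] F := fun k =>
    mfderiv 𝓘(ℝ, F) 𝓘(ℝ, F) (fun k : G => g * k * g⁻¹) k
  have h2 : Ad (F := F) (g * h) = (D (h * 1 * h⁻¹)).comp (Ad h) := hc
  rw [h2, h1]
  rfl

/-- The isotropy subgroup `G_β` of `β` under the coadjoint action
`(Ad^*_{g⁻¹} β)(ξ) = β (Ad_{g⁻¹} ξ)`. -/
def coadjointIsotropy (G : Type*) [TopologicalSpace G] [ChartedSpace F G] [Group G]
    [LieGroup 𝓘(ℝ, F) ∞ G] (β : LieDual F) : Subgroup G where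
  carrier := {g | ∀ ξ : F, β (Ad g⁻¹ ξ) = β ξ}
  one_mem' := by
    intro ξ
    rw [inv_one, Ad_one]
    rfl
  mul_mem' := by
    intro a b ha hb ξ
    rw [mul_inv_rev, Ad_mul]
    exact (hb _).trans (ha ξ)
  inv_mem' := by
    intro a ha ξ
    have h : Ad a⁻¹ (Ad a ξ) = ξ := by
      have := congrArg (fun T : F →L[ℝ] F => T ξ) (Ad_mul (F := F) a⁻¹ a)
      rw [inv_mul_cancel, Ad_one] at this
      exact this.symm
    rw [inv_inv, ← ha (Ad a ξ), h]

end Coadjoint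

section Action

variable {E : Type*} [NormedAddCommGroup E] [NormedSpace ℝ E]
  {M : Type*} [TopologicalSpace M] [ChartedSpace E M] [IsManifold 𝓘(ℝ, E) ∞ M]
  {F : Type*} [NormedAddCommGroup F] [NormedSpace ℝ F]
  {G : Type*} [TopologicalSpace G] [ChartedSpace F G] [Group G]
  [MulAction G M]

/-- The infinitesimal generator `ξ_M(x) = d/dt (exp(tξ) • x)` at `t = 0`, i.e. the image of `ξ`
under the differential at `1` of the orbit map `a ↦ a • x`. -/
def infinitesimalGenerator (E : Type*) [NormedAddCommGroup E] [NormedSpace ℝ E]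
    {M : Type*} [TopologicalSpace M] [ChartedSpace E M]
    (G : Type*) [TopologicalSpace G] [ChartedSpace F G] [Group G] [MulAction G M]
    (ξ : F) (x : M) : TangentSpace 𝓘(ℝ, E) x :=
  (mfderiv 𝓘(ℝ, F) 𝓘(ℝ, E) (fun a : G => a • x) (1 : G) ξ : E)

/-- `G` acts on `(M, g)` by isometries. -/
def ActsByIsometries (G : Type*) [Group G] [MulAction G M] (g : RiemannianMetricOn E M) : Prop :=
  ∀ (a : G) (x : M) (u v : TangentSpace 𝓘(ℝ, E) x),
    g.inner (a • x) (mfderiv 𝓘(ℝ, E) 𝓘(ℝ, E) (fun y : M => a • y) x u)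
      (mfderiv 𝓘(ℝ, E) 𝓘(ℝ, E) (fun y : M => a • y) x v) = g.inner x u v

variable (G) in
/-- The action of `G` on `(M, Ω)` is Hamiltonian with `Ad^*`-equivariant momentum mapping `μ`. -/
structure IsHamiltonianAction (Ω : SymplecticForm E M) (μ : M → LieDual F) : Prop where
  symplectic (a : G) (x : M) (u v : TangentSpace 𝓘(ℝ, E) x) :
    Ω.form (a • x) (mfderiv 𝓘(ℝ, E) 𝓘(ℝ, E) (fun y : M => a • y) x u)
      (mfderiv 𝓘(ℝ, E) 𝓘(ℝ, E) (fun y : M => a • y) x v) = Ω.form x u v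
  contMDiff : ContMDiff 𝓘(ℝ, E) 𝓘(ℝ, LieDual F) ∞ μ
  /-- `d⟨μ, ξ⟩ = Ω(ξ_M, ·)` for each `ξ` in the Lie algebra. -/
  momentum (ξ : F) (x : M) (v : TangentSpace 𝓘(ℝ, E) x) :
    let dμ : LieDual F := mfderiv 𝓘(ℝ, E) 𝓘(ℝ, LieDual F) μ x v
    dμ ξ = Ω.form x (infinitesimalGenerator E G ξ x) v
  equivariant (a : G) (x : M) (ξ : F) : μ (a • x) ξ = μ x (Ad a⁻¹ ξ)

/-- `β` is a regular value of `μ`. -/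
def IsRegularValue (E : Type*) [NormedAddCommGroup E] [NormedSpace ℝ E]
    {M : Type*} [TopologicalSpace M] [ChartedSpace E M]
    (μ : M → LieDual F) (β : LieDual F) : Prop :=
  ∀ x : M, μ x = β → Function.Surjective (mfderiv 𝓘(ℝ, E) 𝓘(ℝ, LieDual F) μ x)

variable [LieGroup 𝓘(ℝ, F) ∞ G]

/-- The level set `μ⁻¹(β)`, with the action of `G_β` inherited from `M`. -/
def levelSet {Ω : SymplecticForm E M} {μ : M → LieDual F} (hμ : IsHamiltonianAction G Ω μ)
    (β : LieDual F) : SubMulAction (coadjointIsotropy G β) M where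
  carrier := μ ⁻¹' {β}
  smul_mem' := by
    rintro ⟨a, ha⟩ x hx
    have hx' : μ x = β := hx
    change μ (a • x) = β
    ext ξ
    rw [hμ.equivariant, hx']
    exact ha ξ

/-- The reduced space `μ⁻¹(β) / G_β`, with the quotient topology. -/
abbrev ReducedSpace {Ω : SymplecticForm E M} {μ : M → LieDual F}
    (hμ : IsHamiltonianAction G Ω μ) (β : LieDual F) :=
  MulAction.orbitRel.Quotient (coadjointIsotropy G β) (levelSet hμ β)

/-- The projection `π_β : μ⁻¹(β) → μ⁻¹(β) / G_β`. -/
def reducedProj {Ω : SymplecticForm E M} {μ : M → LieDual F}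
    (hμ : IsHamiltonianAction G Ω μ) (β : LieDual F) : levelSet hμ β → ReducedSpace hμ β :=
  Quotient.mk _

/-- The action of `G_β` on `μ⁻¹(β)` is free. -/
def IsFreeOnLevel {Ω : SymplecticForm E M} {μ : M → LieDual F}
    (hμ : IsHamiltonianAction G Ω μ) (β : LieDual F) : Prop :=
  ∀ (a : coadjointIsotropy G β) (x : levelSet hμ β), a • x = x → a = 1

/-- The smooth manifold structures on `μ⁻¹(β)` and on `μ⁻¹(β) / G_β`: the first makes `μ⁻¹(β)`
(with the subspace topology) an embedded submanifold of `M`, the second makes the quotient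
(with the quotient topology) a Hausdorff, second countable manifold for which the projection is
a smooth submersion. These properties determine both structures. -/
structure ReducedManifold {Ω : SymplecticForm E M} {μ : M → LieDual F}
    (hμ : IsHamiltonianAction G Ω μ) (β : LieDual F) where
  levelDim : ℕ
  reducedDim : ℕ
  chartedLevel : ChartedSpace (EuclideanSpace ℝ (Fin levelDim)) (levelSet hμ β)
  chartedReduced : ChartedSpace (EuclideanSpace ℝ (Fin reducedDim)) (ReducedSpace hμ β)
  isManifold_level : IsManifold (𝓡 levelDim) ∞ (levelSet hμ β)
  isManifold_reduced : IsManifold (𝓡 reducedDim) ∞ (ReducedSpace hμ β)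
  t2Space_reduced : T2Space (ReducedSpace hμ β)
  secondCountable_reduced : SecondCountableTopology (ReducedSpace hμ β)
  isSmoothEmbedding_incl :
    Manifold.IsSmoothEmbedding (𝓡 levelDim) 𝓘(ℝ, E) ∞ (Subtype.val : levelSet hμ β → M)
  isSubmersion_proj :
    Manifold.IsSubmersion (𝓡 levelDim) (𝓡 reducedDim) ∞ (reducedProj hμ β)

attribute [instance] ReducedManifold.chartedLevel ReducedManifold.chartedReduced
  ReducedManifold.isManifold_level ReducedManifold.isManifold_reduced

end Action

end SymplecticReduction

end

open SymplecticReduction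

open SymplecticReduction

noncomputable section

namespace SymplecticReduction

open Set Filter Topology

/-! ### Inverse function theorem, submersions and maps of constant rank -/

section InverseFunction

variable {V : Type*} [NormedAddCommGroup V] [NormedSpace ℝ V]
  {W : Type*} [NormedAddCommGroup W] [NormedSpace ℝ W]
  {R : Type*} [NormedAddCommGroup R] [NormedSpace ℝ R]

/-! The manifold structures come from one slice chart. If `p` lies over the regular value `β`, the
identity `dμ_p(v)(ξ) = Ω(ξ_M(p), v)` shows that `ξ_M(p) = 0` forces every functional to vanish on
`ξ`, so the orbit map is an immersion at `1` (`injective_orbitDeriv`). Equivariance gives `G_β = {a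
| μ(a • p) = β}`, and left translation relates the differentials of `a ↦ μ(a • p)` at all points.
This map therefore has constant rank, and its kernel `K` at `1` parametrizes `G_β` near `1` by some
`σ` (`exists_coadjointIsotropy_parametrization`); the closed subgroup theorem is not needed.

Choose a transversal `τ(s, w)` to the `G_β`-orbit, inside the level set for `w = 0`, with `μ(τ(s,
w)) = β + w`. By the inverse function theorem `((s, v), w) ↦ σ(v) • τ(s, w)` is a local
diffeomorphism (`exists_slice`). In these coordinates the level set is `w = 0`, and moving `v` stays
in an orbit. Properness and freeness force group elements that return a small neighbourhood to
itself to be close to `1`, hence of the form `σ(v)`; so an orbit meets the chart in a single plaque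
`s = const` (`nonempty_adaptedChart`). Then `(s, v)` is a chart of the level set, `s` is a chart of
the quotient, and transition maps of the quotient are given locally by one group element.

For the metrics only the immersion and submersion properties are used, so the argument applies to
every `ReducedManifold` structure. The inclusion pulls `gM` back. For a surjection `A` and an inner
product `g`, the operator `(A g⁻¹ Aᵗ)⁻¹` is the inner product on the target that makes `A` isometric
on horizontal vectors; it is visibly smooth in `(g, A)` and natural (`pushMetric_map`,
`contDiffAt_pushMetric`). Since `G_β` acts on the level set by isometries over the identity of the
quotient, the result is the same at all points of a fibre and descends
(`exists_isRiemannianSubmersion`). -/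

/-- Inverse function theorem, with a smooth inverse on an open set. -/
theorem exists_openPartialHomeomorph_of_contDiffOn [FiniteDimensional ℝ V] {f : V → W}
    {U : Set V} (hU : IsOpen U)
    (hf : ContDiffOn ℝ ∞ f U) {x₀ : V} (hx₀ : x₀ ∈ U) (f' : V ≃L[ℝ] W)
    (hf' : HasFDerivAt f (f' : V →L[ℝ] W) x₀) :
    ∃ e : OpenPartialHomeomorph V W, x₀ ∈ e.source ∧ e.source ⊆ U ∧ (∀ x, e x = f x) ∧
      ContDiffOn ℝ ∞ e.symm e.target := by
  have hfx : ContDiffAt ℝ ∞ f x₀ := hf.contDiffAt (hU.mem_nhds hx₀)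
  let e₀ := hfx.toOpenPartialHomeomorph f hf' (by simp)
  have hcont : ContinuousOn (fderiv ℝ f) U := hf.continuousOn_fderiv_of_isOpen hU (by simp)
  -- On `O` the differential stays invertible, so the inverse is smooth on the whole target and not
  -- only at `f x₀`.
  let O : Set V := U ∩ fderiv ℝ f ⁻¹' range ((↑) : (V ≃L[ℝ] W) → V →L[ℝ] W)
  have hO : IsOpen O := hcont.isOpen_inter_preimage hU ContinuousLinearEquiv.isOpen
  refine ⟨e₀.restrOpen O hO, ?_, ?_, fun x => rfl, ?_⟩
  · refine ⟨hfx.mem_toOpenPartialHomeomorph_source hf' (by simp), hx₀, f', hf'.fderiv.symm⟩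
  · rintro x ⟨-, hx, -⟩
    exact hx
  · intro y hy
    have hs := (e₀.restrOpen O hO).map_target hy
    obtain ⟨-, hxU, g, hg⟩ := hs
    have hd : HasFDerivAt f (g : V →L[ℝ] W) ((e₀.restrOpen O hO).symm y) := by
      rw [hg]
      exact ((hf.contDiffAt (hU.mem_nhds hxU)).differentiableAt (by simp)).hasFDerivAt
    exact ((e₀.restrOpen O hO).contDiffAt_symm hy hd
      (hf.contDiffAt (hU.mem_nhds hxU))).contDiffWithinAt

/-- For a right inverse `S` of `A`, the operator `B ∘ S` remains invertible for `B` near `A`, and `S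
∘ (B ∘ S)⁻¹` is then a right inverse of `B`. -/
theorem isOpen_setOf_surjective [FiniteDimensional ℝ R] :
    IsOpen {A : V →L[ℝ] R | Function.Surjective A} := by
  rw [isOpen_iff_mem_nhds]
  intro A hA
  obtain ⟨S, hS⟩ := (A : V →ₗ[ℝ] R).exists_rightInverse_of_surjective (LinearMap.range_eq_top.2 hA)
  let S' : R →L[ℝ] V := S.toContinuousLinearMap
  have hc : Continuous fun B : V →L[ℝ] R => B ∘L S' := continuous_id.clm_comp_const S'
  have hAS : A ∘L S' ∈ range ((↑) : (R ≃L[ℝ] R) → R →L[ℝ] R) :=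
    ⟨ContinuousLinearEquiv.refl ℝ R, by ext x; exact (LinearMap.congr_fun hS x).symm⟩
  filter_upwards [(ContinuousLinearEquiv.isOpen.preimage hc).mem_nhds hAS]
  rintro B ⟨g, hg⟩ r
  refine ⟨S' (g.symm r), ?_⟩
  have := congrArg (fun T : R →L[ℝ] R => T (g.symm r)) hg
  simpa using this.symm

/-- A submersion between vector spaces is locally a linear projection. -/
theorem exists_straightening [FiniteDimensional ℝ V] {f : V → R} {U : Set V} (hU : IsOpen U)
    (hf : ContDiffOn ℝ ∞ f U) {x₀ : V} (hx₀ : x₀ ∈ U) {f' : V →L[ℝ] R}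
    (hf' : HasFDerivAt f f' x₀) (hsurj : Function.Surjective f')
    (K : Submodule ℝ V) (hK : ∀ x, x ∈ K ↔ f' x = 0) :
    ∃ e : OpenPartialHomeomorph V (K × R), x₀ ∈ e.source ∧ e.source ⊆ U ∧ e x₀ = 0 ∧
      (∀ x, (e x).2 = f x - f x₀) ∧ ContDiffOn ℝ ∞ e.symm e.target ∧
      ∃ e' : K × R →L[ℝ] V, HasFDerivAt e.symm e' 0 ∧ (∀ k : K, e' (k, 0) = k) ∧
        ∀ z, f' (e' z) = z.2 := by
  obtain ⟨Q, hQ⟩ := K.exists_isCompl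
  let q : V →L[ℝ] K := (K.projectionOnto Q hQ).toContinuousLinearMap
  have hq : ∀ k : K, q k = k := fun k => Submodule.projectionOnto_apply_left hQ k
  let T : V →L[ℝ] K × R := q.prod f'
  have hTinj : Function.Injective T := by
    rw [injective_iff_map_eq_zero]
    intro x hx
    have h1 : q x = 0 := congrArg Prod.fst hx
    have h2 : f' x = 0 := congrArg Prod.snd hx
    have := hq ⟨x, (hK x).2 h2⟩
    rw [show ((⟨x, (hK x).2 h2⟩ : K) : V) = x from rfl, h1] at this
    exact congrArg Subtype.val this.symm
  have hTsurj : Function.Surjective T := by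
    rintro ⟨k, r⟩
    obtain ⟨x, hx⟩ := hsurj r
    -- Replacing the `K`-component of a preimage of `r` by `k` does not change its image under `f'`.
    refine ⟨x - q x + k, ?_⟩
    have h1 : f' (q x : V) = 0 := (hK _).1 (q x).2
    have h2 : f' (k : V) = 0 := (hK _).1 k.2
    ext1
    · change q (x - q x + k) = k
      rw [map_add, map_sub, hq, hq, sub_self, zero_add]
    · change f' (x - q x + k) = r
      rw [map_add, map_sub, h1, h2, hx, sub_zero, add_zero]
  let Te : V ≃L[ℝ] K × R :=
    (LinearEquiv.ofBijective (T : V →ₗ[ℝ] K × R) ⟨hTinj, hTsurj⟩).toContinuousLinearEquiv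
  have hTe : (Te : V →L[ℝ] K × R) = T := by ext x <;> rfl
  let g : V → K × R := fun x => (q (x - x₀), f x - f x₀)
  have hg : ContDiffOn ℝ ∞ g U :=
    (q.contDiff.comp_contDiffOn (contDiffOn_id.sub contDiffOn_const)).prodMk
      (hf.sub contDiffOn_const)
  have hg' : HasFDerivAt g (Te : V →L[ℝ] K × R) x₀ := by
    rw [hTe]
    exact (q.hasFDerivAt.comp x₀ ((hasFDerivAt_id x₀).sub_const x₀)).prodMk (hf'.sub_const _)
  obtain ⟨e, he₁, he₂, he₃, he₄⟩ := exists_openPartialHomeomorph_of_contDiffOn hU hg hx₀ Te hg'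
  have he0 : e x₀ = 0 := by rw [he₃]; simp [g]
  have hsymm : e.symm 0 = x₀ := by rw [← he0, e.left_inv he₁]
  refine ⟨e, he₁, he₂, he0, fun x => by rw [he₃], he₄, (Te.symm : K × R →L[ℝ] V), ?_, ?_, ?_⟩
  · refine e.hasFDerivAt_symm (he0 ▸ e.map_source he₁) ?_
    rw [hsymm]
    exact hg'.congr_of_eventuallyEq (Eventually.of_forall he₃)
  · intro k
    change Te.symm (k, 0) = (k : V)
    rw [ContinuousLinearEquiv.symm_apply_eq]
    ext1
    · exact (hq k).symm
    · exact ((hK _).1 k.2).symm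
  · intro z
    exact congrArg Prod.snd (Te.apply_symm_apply z)

/-- Constant rank theorem: the level set through `x₀` of a map whose differentials factor
through the differential at `x₀` is parametrized by the kernel of that differential. -/
theorem exists_levelSet_parametrization [FiniteDimensional ℝ V]
    [FiniteDimensional ℝ W] {f : V → W} {U : Set V} (hU : IsOpen U)
    (hf : ContDiffOn ℝ ∞ f U) {x₀ : V} (hx₀ : x₀ ∈ U) {f' : V →L[ℝ] W}
    (hf' : HasFDerivAt f f' x₀)
    (hrank : ∀ x ∈ U, ∃ (T : W →L[ℝ] W) (S : V →L[ℝ] V), HasFDerivAt f (T ∘L f' ∘L S) x)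
    (K : Submodule ℝ V) (hK : ∀ x, x ∈ K ↔ f' x = 0) :
    ∃ (σ : K → V) (B : Set K), IsOpen B ∧ 0 ∈ B ∧ ContDiffOn ℝ ∞ σ B ∧ σ 0 = x₀ ∧
      (∀ v ∈ B, σ v ∈ U ∧ f (σ v) = f x₀) ∧ HasFDerivAt σ K.subtypeL 0 ∧
      ∀ O ∈ 𝓝 (0 : K), ∀ᶠ x in 𝓝 x₀, f x = f x₀ → ∃ v ∈ O, x = σ v := by
  -- Composing `f` with a projection `P` onto the range of `f'` gives a submersion near `x₀`, whose
  -- level set is straightened. What remains is that `f` itself, and not only `P ∘ f`, is constant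
  -- along that level set.
  let R : Submodule ℝ W := LinearMap.range (f' : V →ₗ[ℝ] W)
  obtain ⟨Q, hQ⟩ := R.exists_isCompl
  let P : W →L[ℝ] R := (R.projectionOnto Q hQ).toContinuousLinearMap
  have hP : ∀ r : R, P r = r := fun r => Submodule.projectionOnto_apply_left hQ r
  have hPf : ∀ x, P (f' x) = ⟨f' x, x, rfl⟩ := fun x => hP ⟨f' x, x, rfl⟩
  have hPf' : HasFDerivAt (fun x => P (f x)) (P ∘L f') x₀ := P.hasFDerivAt.comp x₀ hf'
  have hsurj : Function.Surjective (P ∘L f') := by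
    rintro ⟨_, x, rfl⟩
    exact ⟨x, hPf x⟩
  have hK' : ∀ x, x ∈ K ↔ (P ∘L f') x = 0 := by
    intro x
    rw [hK, ContinuousLinearMap.comp_apply, hPf]
    exact (Submodule.mk_eq_zero (p := R) ..).symm
  -- shrink `U` so that the projected differential stays onto
  let U' : Set V := U ∩ fderiv ℝ (fun x => P (f x)) ⁻¹' {A : V →L[ℝ] R | Function.Surjective A}
  have hPc : ContDiffOn ℝ ∞ (fun x => P (f x)) U := P.contDiff.comp_contDiffOn hf
  have hU' : IsOpen U' :=
    (hPc.continuousOn_fderiv_of_isOpen hU (by simp)).isOpen_inter_preimage hU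
      isOpen_setOf_surjective
  have hx₀' : x₀ ∈ U' := ⟨hx₀, by
    change Function.Surjective _
    rw [hPf'.fderiv]
    exact hsurj⟩
  obtain ⟨e, he₁, he₂, he₃, he₄, he₅, e', he'₁, he'₂, he'₃⟩ :=
    exists_straightening hU' (hPc.mono inter_subset_left) hx₀' hPf' hsurj K hK'
  have h0t : (0 : K × R) ∈ e.target := he₃ ▸ e.map_source he₁
  have hpre : (fun v : K => ((v, 0) : K × R)) ⁻¹' e.target ∈ 𝓝 (0 : K) :=
    (Continuous.prodMk_left (0 : R)).continuousAt.preimage_mem_nhds (e.open_target.mem_nhds h0t)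
  obtain ⟨ε, hε, hball⟩ := Metric.mem_nhds_iff.1 hpre
  have hmaps : ∀ v ∈ Metric.ball (0 : K) ε, e.symm (v, 0) ∈ U' := fun v hv =>
    he₂ (e.map_target (hball hv))
  have hσ : ContDiffOn ℝ ∞ (fun v : K => e.symm (v, 0)) (Metric.ball 0 ε) :=
    he₅.comp (contDiff_prodMk_left (0 : R)).contDiffOn hball
  have hsymm : e.symm 0 = x₀ := by rw [← he₃, e.left_inv he₁]
  have hconst : ∀ v ∈ Metric.ball (0 : K) ε, f (e.symm (v, 0)) = f x₀ := by
    intro v hv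
    have hcomp : ContDiffOn ℝ ∞ (fun v : K => f (e.symm (v, 0))) (Metric.ball 0 ε) :=
      hf.comp hσ fun v hv => (hmaps v hv).1
    have := Metric.isOpen_ball.is_const_of_fderiv_eq_zero
      (convex_ball (0 : K) ε).isPreconnected (hcomp.differentiableOn (by simp))
      (fun w hw => ?_) hv (Metric.mem_ball_self hε)
    · simpa only [show ((0 : K), (0 : R)) = 0 from rfl, hsymm] using this
    · obtain ⟨hwU, hwS⟩ := hmaps w hw
      obtain ⟨T, S, hTS⟩ := hrank _ hwU
      have hPTS : HasFDerivAt (fun x => P (f x)) (P ∘L (T ∘L f' ∘L S)) (e.symm (w, 0)) :=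
        P.hasFDerivAt.comp _ hTS
      have hwS' : Function.Surjective (P ∘L (T ∘L f' ∘L S)) := by
        rw [← hPTS.fderiv]
        exact hwS
      have hdσ := ((hσ.contDiffAt (Metric.isOpen_ball.mem_nhds hw)).differentiableAt
        (by simp)).hasFDerivAt
      have hdf : HasFDerivAt (fun v : K => f (e.symm (v, 0))) _ w :=
        HasFDerivAt.comp (g := f) (f := fun v : K => e.symm (v, 0)) w hTS hdσ
      rw [hdf.fderiv]
      have hz : (P ∘L (T ∘L f' ∘L S)) ∘L fderiv ℝ (fun v : K => e.symm (v, 0)) w = 0 := by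
        have h1 : HasFDerivAt (fun v : K => P (f (e.symm (v, 0)))) _ w :=
          HasFDerivAt.comp (g := fun x => P (f x)) (f := fun v : K => e.symm (v, 0)) w hPTS hdσ
        refine h1.unique ((hasFDerivAt_const (P (f x₀)) w).congr_of_eventuallyEq ?_)
        filter_upwards [Metric.isOpen_ball.mem_nhds hw] with v hv
        have := he₄ (e.symm (v, 0))
        rw [e.right_inv (hball hv)] at this
        exact (sub_eq_zero.1 this.symm)
      -- `P` is injective on the range of the differential
      let TS : V →ₗ[ℝ] W := (T ∘L f' ∘L S : V →L[ℝ] W)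
      -- The rank at the present point is at most the rank of `f'`, while `P` maps the present range
      -- onto `R`; the dimensions therefore agree.
      have hfin : Module.finrank ℝ (LinearMap.range TS) ≤ Module.finrank ℝ R := by
        have h1 : LinearMap.range TS ≤ R.map (T : W →ₗ[ℝ] W) := by
          rintro _ ⟨x, rfl⟩
          exact ⟨f' (S x), ⟨S x, rfl⟩, rfl⟩
        exact (Submodule.finrank_mono h1).trans (Submodule.finrank_map_le _ _)
      let PR : LinearMap.range TS →ₗ[ℝ] R := (P : W →ₗ[ℝ] R).domRestrict _
      have hPRs : Function.Surjective PR := by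
        intro r
        obtain ⟨x, hx⟩ := hwS' r
        exact ⟨⟨TS x, x, rfl⟩, hx⟩
      have hPRi : Function.Injective PR :=
        (LinearMap.injective_iff_surjective_of_finrank_eq_finrank
          (le_antisymm hfin (LinearMap.finrank_le_finrank_of_surjective hPRs))).2 hPRs
      ext u
      have h2 : PR ⟨TS (fderiv ℝ (fun v : K => e.symm (v, 0)) w u), _, rfl⟩ = 0 :=
        congrArg (fun A : K →L[ℝ] R => A u) hz
      exact congrArg Subtype.val (hPRi (h2.trans (map_zero PR).symm))
  refine ⟨fun v => e.symm (v, 0), Metric.ball 0 ε, Metric.isOpen_ball, Metric.mem_ball_self hε,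
    hσ, hsymm, fun v hv => ⟨(hmaps v hv).1, hconst v hv⟩, ?_, ?_⟩
  · have h1 : HasFDerivAt (fun v : K => ((v, 0) : K × R)) (ContinuousLinearMap.inl ℝ K R) 0 :=
      (ContinuousLinearMap.inl ℝ K R).hasFDerivAt
    have h2 := HasFDerivAt.comp (0 : K) (g := e.symm) (f := fun v : K => ((v, 0) : K × R)) he'₁ h1
    have h3 : K.subtypeL = e' ∘L ContinuousLinearMap.inl ℝ K R := by
      refine ContinuousLinearMap.ext fun k => (he'₂ k).symm
    rw [h3]
    exact h2
  · intro O hO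
    have hc : Tendsto (fun x => (e x).1) (𝓝 x₀) (𝓝 0) := by
      have := (continuous_fst.tendsto _).comp (e.continuousAt he₁)
      rwa [he₃] at this
    filter_upwards [e.open_source.mem_nhds he₁, hc hO] with x hx hxO hfx
    refine ⟨(e x).1, hxO, ?_⟩
    have h2 : (e x).2 = 0 := by rw [he₄, hfx, sub_self]
    rw [← h2, Prod.mk.eta, e.left_inv hx]

end InverseFunction

/-! ### Slices for a local action, in coordinates -/

section Slice

variable {F : Type*} [NormedAddCommGroup F] [NormedSpace ℝ F] [FiniteDimensional ℝ F]
  {E : Type*} [NormedAddCommGroup E] [NormedSpace ℝ E] [FiniteDimensional ℝ E]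
  {C : Type*} [NormedAddCommGroup C] [NormedSpace ℝ C] [FiniteDimensional ℝ C]

/-- A slice for a local action `A`, in coordinates: `σ` parametrizes the local isotropy subgroup
of a value of `m`, and `τ` parametrizes a submanifold transverse to its orbit. -/
theorem exists_slice {A : F × E → E} {W : Set (F × E)} (hW : IsOpen W) {g₀ : F} {x₀ : E}
    (hW₀ : (g₀, x₀) ∈ W) (hA : ContDiffOn ℝ ∞ A W) (hA₁ : ∀ x, (g₀, x) ∈ W → A (g₀, x) = x)
    {δ : F →L[ℝ] E} (hδ : HasFDerivAt (fun g => A (g, x₀)) δ g₀) (hδinj : Function.Injective δ)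
    {m : E → C} {X : Set E} (hX : IsOpen X) (hx₀ : x₀ ∈ X) (hm : ContDiffOn ℝ ∞ m X)
    {m' : E →L[ℝ] C} (hm' : HasFDerivAt m m' x₀) (hm'surj : Function.Surjective m')
    (K : Submodule ℝ F) (hK : ∀ ξ, ξ ∈ K ↔ m' (δ ξ) = 0)
    {σ : K → F} {B : Set K} (hB : IsOpen B) (hB₀ : 0 ∈ B) (hσ : ContDiffOn ℝ ∞ σ B)
    (hσ₀ : σ 0 = g₀) (hσ' : HasFDerivAt σ K.subtypeL 0)
    {d : ℕ} (hd : d + Module.finrank ℝ K + Module.finrank ℝ C = Module.finrank ℝ E) :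
    ∃ (τ : EuclideanSpace ℝ (Fin d) × C → E) (B' : Set (EuclideanSpace ℝ (Fin d) × C)),
      IsOpen B' ∧ ContDiffOn ℝ ∞ τ B' ∧ MapsTo τ B' X ∧ τ 0 = x₀ ∧
      (∀ z ∈ B', m (τ z) = m x₀ + z.2) ∧
      ∃ e : OpenPartialHomeomorph ((EuclideanSpace ℝ (Fin d) × K) × C) E,
        0 ∈ e.source ∧
        (∀ z ∈ e.source, z.1.2 ∈ B ∧ (z.1.1, z.2) ∈ B' ∧ (σ z.1.2, τ (z.1.1, z.2)) ∈ W) ∧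
        (∀ z, e z = A (σ z.1.2, τ (z.1.1, z.2))) ∧
        ContDiffOn ℝ ∞ e e.source ∧ ContDiffOn ℝ ∞ e.symm e.target := by
  let D := EuclideanSpace ℝ (Fin d)
  let Z : Submodule ℝ E := LinearMap.ker (m' : E →ₗ[ℝ] C)
  obtain ⟨e₁, he₁, he₁X, he₁0, he₁m, he₁s, e₁', he₁', he₁Z, he₁C⟩ :=
    exists_straightening hX hm hx₀ hm' hm'surj Z (fun x => LinearMap.mem_ker)
  have hsymm₁ : e₁.symm 0 = x₀ := by rw [← he₁0, e₁.left_inv he₁]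
  -- a complement of the orbit directions in the kernel of `m'`
  let δK : K →ₗ[ℝ] Z :=
    ((δ : F →ₗ[ℝ] E).comp K.subtype).codRestrict Z fun ξ => (hK _).1 ξ.2
  have hδK : Function.Injective δK := by
    intro a b hab
    exact Subtype.ext (hδinj (congrArg Subtype.val hab))
  obtain ⟨D', hD'⟩ := (LinearMap.range δK).exists_isCompl
  have hZ : Module.finrank ℝ Z + Module.finrank ℝ C = Module.finrank ℝ E := by
    have h : Module.finrank ℝ (LinearMap.range (m' : E →ₗ[ℝ] C)) + Module.finrank ℝ Z = _ :=
      (m' : E →ₗ[ℝ] C).finrank_range_add_finrank_ker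
    rw [LinearMap.range_eq_top.2 hm'surj, finrank_top] at h
    omega
  have hfin : Module.finrank ℝ D = Module.finrank ℝ D' := by
    have h1 := Submodule.finrank_add_eq_of_isCompl hD'
    rw [LinearMap.finrank_range_of_inj hδK] at h1
    have h2 : Module.finrank ℝ D = d := finrank_euclideanSpace_fin
    omega
  let J : D ≃L[ℝ] D' := ContinuousLinearEquiv.ofFinrankEq hfin
  let j : D →L[ℝ] Z := D'.subtypeL ∘L (J : D →L[ℝ] D')
  -- In the coordinates `e₁` the second component is the increment of `m`; `s` is sent into a
  -- complement of the orbit directions within `ker m'`.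
  let τ : D × C → E := fun z => e₁.symm (j z.1, z.2)
  let jC : D × C →L[ℝ] Z × C := j.prodMap (ContinuousLinearMap.id ℝ C)
  let B' : Set (D × C) := jC ⁻¹' e₁.target
  have hB' : IsOpen B' := e₁.open_target.preimage jC.continuous
  have hτ : ContDiffOn ℝ ∞ τ B' := he₁s.comp jC.contDiff.contDiffOn fun _ h => h
  have hτX : MapsTo τ B' X := fun z hz => he₁X (e₁.map_target hz)
  have hτ0 : τ 0 = x₀ := by
    change e₁.symm (j 0, 0) = x₀
    rw [map_zero]
    exact hsymm₁
  have hτm : ∀ z ∈ B', m (τ z) = m x₀ + z.2 := by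
    intro z hz
    have := he₁m (τ z)
    rw [show e₁ (τ z) = (j z.1, z.2) from e₁.right_inv hz] at this
    rw [show z.2 = m (τ z) - m x₀ from this]
    abel
  have hB'0 : (0 : D × C) ∈ B' := by
    change jC 0 ∈ e₁.target
    rw [map_zero, ← he₁0]
    exact e₁.map_source he₁
  have hτ' : HasFDerivAt τ (e₁' ∘L jC) 0 := by
    have h0 : HasFDerivAt e₁.symm e₁' (jC 0) := by rwa [map_zero]
    exact HasFDerivAt.comp (g := e₁.symm) (f := jC) 0 h0 jC.hasFDerivAt
  -- the slice map
  let st : (D × K) × C → F × E := fun z => (σ z.1.2, τ (z.1.1, z.2))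
  let pDC : (D × K) × C →L[ℝ] D × C :=
    ((ContinuousLinearMap.fst ℝ D K) ∘L (ContinuousLinearMap.fst ℝ (D × K) C)).prod
      (ContinuousLinearMap.snd ℝ (D × K) C)
  let pK : (D × K) × C →L[ℝ] K :=
    (ContinuousLinearMap.snd ℝ D K) ∘L (ContinuousLinearMap.fst ℝ (D × K) C)
  let U₀ : Set ((D × K) × C) := pK ⁻¹' B ∩ pDC ⁻¹' B'
  have hU₀ : IsOpen U₀ := (hB.preimage pK.continuous).inter (hB'.preimage pDC.continuous)
  have hst : ContDiffOn ℝ ∞ st U₀ :=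
    (hσ.comp pK.contDiff.contDiffOn fun _ h => h.1).prodMk
      (hτ.comp pDC.contDiff.contDiffOn fun _ h => h.2)
  let U : Set ((D × K) × C) := U₀ ∩ st ⁻¹' W
  have hU : IsOpen U := hst.continuousOn.isOpen_inter_preimage hU₀ hW
  have hst0 : st 0 = (g₀, x₀) := Prod.ext hσ₀ hτ0
  have h0U : (0 : (D × K) × C) ∈ U := by
    refine ⟨⟨?_, ?_⟩, ?_⟩
    · change pK 0 ∈ B
      rwa [map_zero]
    · change pDC 0 ∈ B'
      rwa [map_zero]
    · change st 0 ∈ W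
      rwa [hst0]
  have hΨ : ContDiffOn ℝ ∞ (fun z => A (st z)) U := hA.comp (hst.mono inter_subset_left)
    fun _ h => h.2
  -- its differential at the origin
  have hst' : HasFDerivAt st ((K.subtypeL ∘L pK).prod (e₁' ∘L jC ∘L pDC)) 0 := by
    refine HasFDerivAt.prodMk ?_ ?_
    · have h0 : HasFDerivAt σ K.subtypeL (pK 0) := by rwa [map_zero]
      exact HasFDerivAt.comp (g := σ) (f := pK) 0 h0 pK.hasFDerivAt
    · have h0 : HasFDerivAt τ (e₁' ∘L jC) (pDC 0) := by rwa [map_zero]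
      exact HasFDerivAt.comp (g := τ) (f := pDC) 0 h0 pDC.hasFDerivAt
  have hAd : HasFDerivAt A (fderiv ℝ A (g₀, x₀)) (g₀, x₀) :=
    ((hA.contDiffAt (hW.mem_nhds hW₀)).differentiableAt (by simp)).hasFDerivAt
  have hA1 : ∀ ξ, fderiv ℝ A (g₀, x₀) (ξ, 0) = δ ξ := by
    intro ξ
    have h1 : HasFDerivAt (fun g => A (g, x₀)) _ g₀ :=
      HasFDerivAt.comp (g := A) (f := fun g => (g, x₀)) g₀ hAd
        ((hasFDerivAt_id g₀).prodMk (hasFDerivAt_const x₀ g₀))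
    exact congrArg (fun T : F →L[ℝ] E => T ξ) (h1.unique hδ)
  have hA2 : ∀ u, fderiv ℝ A (g₀, x₀) (0, u) = u := by
    intro u
    have h1 : HasFDerivAt (fun x => A (g₀, x)) _ x₀ :=
      HasFDerivAt.comp (g := A) (f := fun x => (g₀, x)) x₀ hAd
        ((hasFDerivAt_const g₀ x₀).prodMk (hasFDerivAt_id x₀))
    have h2 : HasFDerivAt (fun x => A (g₀, x)) (ContinuousLinearMap.id ℝ E) x₀ := by
      refine (hasFDerivAt_id x₀).congr_of_eventuallyEq ?_
      have hc : Continuous fun x : E => (g₀, x) := Continuous.prodMk_right g₀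
      filter_upwards [(hW.preimage hc).mem_nhds hW₀] with x hx
      exact hA₁ x hx
    exact congrArg (fun T : E →L[ℝ] E => T u) (h1.unique h2)
  let T : (D × K) × C →L[ℝ] E :=
    fderiv ℝ A (g₀, x₀) ∘L ((K.subtypeL ∘L pK).prod (e₁' ∘L jC ∘L pDC))
  have hT : ∀ z, T z = δ (z.1.2 : F) + e₁' (j z.1.1, z.2) := by
    intro z
    have h1 : T z = fderiv ℝ A (g₀, x₀) ((z.1.2 : F), e₁' (j z.1.1, z.2)) := rfl
    have h2 : (((z.1.2 : F), e₁' (j z.1.1, z.2)) : F × E) =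
        ((z.1.2 : F), 0) + (0, e₁' (j z.1.1, z.2)) := by simp
    rw [h1, h2, map_add, hA1, hA2]
  have hΨ' : HasFDerivAt (fun z => A (st z)) T 0 := by
    have h0 : HasFDerivAt A (fderiv ℝ A (g₀, x₀)) (st 0) := by rwa [hst0]
    exact HasFDerivAt.comp (g := A) (f := st) 0 h0 hst'
  -- Applying `m'` isolates `w`, because both `δ v` and `j s` lie in its kernel. The remaining
  -- relation `δ v + j s = 0` splits along the complement `D'`.
  have hTinj : Function.Injective T := by
    rw [injective_iff_map_eq_zero]
    rintro ⟨⟨s, v⟩, w⟩ hz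
    rw [hT] at hz
    have hw : w = 0 := by
      have h1 := congrArg m' hz
      rw [map_add, map_zero, he₁C, (hK _).1 v.2, zero_add] at h1
      exact h1
    subst hw
    rw [he₁Z] at hz
    have h1 : δK v + j s = 0 := Subtype.ext hz
    have h2 : j s ∈ LinearMap.range δK := ⟨-v, by rw [map_neg, neg_eq_of_add_eq_zero_right h1]⟩
    have h3 : j s = 0 := (Submodule.disjoint_def.1 hD'.disjoint) _ h2 (J s).2
    rw [h3, add_zero] at h1
    have h4 : v = 0 := hδK (h1.trans (map_zero _).symm)
    have h5 : s = 0 := J.injective ((Subtype.ext h3).trans (map_zero J).symm)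
    rw [h4, h5]
    rfl
  have hdim : Module.finrank ℝ ((D × K) × C) = Module.finrank ℝ E := by
    rw [Module.finrank_prod, Module.finrank_prod, ← hd, finrank_euclideanSpace_fin]
  let Te : ((D × K) × C) ≃L[ℝ] E := (LinearEquiv.ofBijective (T : (D × K) × C →ₗ[ℝ] E)
    ⟨hTinj, (LinearMap.injective_iff_surjective_of_finrank_eq_finrank hdim).1
      hTinj⟩).toContinuousLinearEquiv
  have hTe : (Te : (D × K) × C →L[ℝ] E) = T := ContinuousLinearMap.ext fun z => rfl
  obtain ⟨e, he0, heU, hef, hes⟩ :=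
    exists_openPartialHomeomorph_of_contDiffOn hU hΨ h0U Te (hTe ▸ hΨ')
  refine ⟨τ, B', hB', hτ, hτX, hτ0, hτm, e, he0, fun z hz => ?_, hef, ?_, hes⟩
  · exact ⟨(heU hz).1.1, (heU hz).1.2, (heU hz).2⟩
  · exact (hΨ.mono heU).congr fun z _ => hef z

end Slice

/-! ### Charts of a quotient from charts with straight fibres -/

section QuotientChart

variable {N Q E₁ D K : Type*} [TopologicalSpace N]
  [NormedAddCommGroup E₁] [NormedSpace ℝ E₁] [NormedAddCommGroup D] [NormedSpace ℝ D]
  [NormedAddCommGroup K] [NormedSpace ℝ K]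
  {π : N → Q} {φ : OpenPartialHomeomorph N E₁} {L : E₁ ≃L[ℝ] D × K}

open Classical in
/-- The value on `q` of the chart of the quotient induced by `φ`. -/
def quotientChartFun (π : N → Q) (φ : OpenPartialHomeomorph N E₁) (L : E₁ ≃L[ℝ] D × K)
    (q : Q) : D :=
  if h : ∃ y ∈ φ.source, π y = q then (L (φ h.choose)).1 else 0

open Classical in
/-- The value at `s` of the inverse of the chart of the quotient induced by `φ`. -/
def quotientChartInv (π : N → Q) (φ : OpenPartialHomeomorph N E₁) (L : E₁ ≃L[ℝ] D × K)
    (s : D) : Q :=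
  π (φ.symm (L.symm (s, if h : ∃ v, L.symm (s, v) ∈ φ.target then h.choose else 0)))

/-- By `hφ` the first coordinate is constant on the part of a fibre inside the chart, so the chosen
preimage does not matter. -/
lemma quotientChartFun_apply
    (hφ : ∀ y ∈ φ.source, ∀ y' ∈ φ.source, (L (φ y)).1 = (L (φ y')).1 ↔ π y = π y')
    {y : N} (hy : y ∈ φ.source) : quotientChartFun π φ L (π y) = (L (φ y)).1 := by
  have h : ∃ y' ∈ φ.source, π y' = π y := ⟨y, hy, rfl⟩
  rw [quotientChartFun, dif_pos h]
  exact (hφ _ h.choose_spec.1 _ hy).2 h.choose_spec.2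

lemma quotientChartInv_apply
    (hφ : ∀ y ∈ φ.source, ∀ y' ∈ φ.source, (L (φ y)).1 = (L (φ y')).1 ↔ π y = π y')
    {s : D} {v : K} (hv : L.symm (s, v) ∈ φ.target) :
    quotientChartInv π φ L s = π (φ.symm (L.symm (s, v))) := by
  have h : ∃ v, L.symm (s, v) ∈ φ.target := ⟨v, hv⟩
  rw [quotientChartInv, dif_pos h]
  rw [← hφ _ (φ.map_target h.choose_spec) _ (φ.map_target hv), φ.right_inv h.choose_spec,
    φ.right_inv hv, L.apply_symm_apply, L.apply_symm_apply]

/-- A chart `φ` of `N` in which the fibres of the open map `π` are the slices `{s} × K` induces a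
chart of the target of `π`. -/
def quotientChart [TopologicalSpace Q] (hπ : Continuous π) (hπo : IsOpenMap π)
    (hφ : ∀ y ∈ φ.source, ∀ y' ∈ φ.source, (L (φ y)).1 = (L (φ y')).1 ↔ π y = π y') :
    OpenPartialHomeomorph Q D where
  toFun := quotientChartFun π φ L
  invFun := quotientChartInv π φ L
  source := π '' φ.source
  target := Prod.fst '' (L '' φ.target)
  map_source' := by
    rintro _ ⟨y, hy, rfl⟩
    rw [quotientChartFun_apply hφ hy]
    exact ⟨_, ⟨_, φ.map_source hy, rfl⟩, rfl⟩
  map_target' := by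
    rintro _ ⟨_, ⟨z, hz, rfl⟩, rfl⟩
    have hz' : L.symm ((L z).1, (L z).2) ∈ φ.target := by simpa using hz
    rw [quotientChartInv_apply hφ hz']
    exact ⟨_, φ.map_target hz', rfl⟩
  left_inv' := by
    rintro _ ⟨y, hy, rfl⟩
    have hz' : L.symm ((L (φ y)).1, (L (φ y)).2) ∈ φ.target := by simpa using φ.map_source hy
    rw [quotientChartFun_apply hφ hy, quotientChartInv_apply hφ hz']
    simp [φ.left_inv hy]
  right_inv' := by
    rintro _ ⟨_, ⟨z, hz, rfl⟩, rfl⟩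
    have hz' : L.symm ((L z).1, (L z).2) ∈ φ.target := by simpa using hz
    rw [quotientChartInv_apply hφ hz', quotientChartFun_apply hφ (φ.map_target hz'),
      φ.right_inv hz', L.apply_symm_apply]
  open_source := hπo _ φ.open_source
  open_target := isOpenMap_fst _ (L.toHomeomorph.isOpenMap _ φ.open_target)
  continuousOn_toFun := by
    rw [continuousOn_open_iff (hπo _ φ.open_source)]
    intro O hO
    have hc : ContinuousOn (fun y => (L (φ y)).1) φ.source :=
      (continuous_fst.comp L.continuous).comp_continuousOn φ.continuousOn
    -- The preimage of `O` under the chart is the `π`-image of the open set of points whose first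
    -- coordinate lies in `O`.
    convert hπo _ (hc.isOpen_inter_preimage φ.open_source hO) using 1
    ext q
    constructor
    · rintro ⟨⟨y, hy, rfl⟩, hq⟩
      rw [mem_preimage, quotientChartFun_apply hφ hy] at hq
      exact ⟨y, ⟨hy, hq⟩, rfl⟩
    · rintro ⟨y, ⟨hy, hq⟩, rfl⟩
      refine ⟨⟨y, hy, rfl⟩, ?_⟩
      rw [mem_preimage, quotientChartFun_apply hφ hy]
      exact hq
  continuousOn_invFun := by
    rintro _ ⟨_, ⟨z, hz, rfl⟩, rfl⟩
    have hz' : L.symm ((L z).1, (L z).2) ∈ φ.target := by simpa using hz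
    -- Near the given point the second coordinate can be frozen at `(L z).2`; this replaces the
    -- pointwise choice in `quotientChartInv` by a continuous one.
    have hc : Continuous fun s : D => L.symm (s, (L z).2) :=
      L.symm.continuous.comp (Continuous.prodMk_left _)
    refine ContinuousAt.continuousWithinAt ?_
    have h1 : ContinuousAt (fun s : D => π (φ.symm (L.symm (s, (L z).2)))) (L z).1 :=
      hπ.continuousAt.comp (ContinuousAt.comp (g := φ.symm)
        (φ.continuousAt_symm hz') hc.continuousAt)
    refine h1.congr ?_
    filter_upwards [(φ.open_target.preimage hc).mem_nhds hz'] with s hs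
    exact (quotientChartInv_apply hφ hs).symm

end QuotientChart

/-! ### Charts adapted to an invariant subset and its orbits -/

section AdaptedChart

variable {E : Type*} [NormedAddCommGroup E] [NormedSpace ℝ E]
  {M : Type*} [TopologicalSpace M] [ChartedSpace E M]
  {Γ : Type*} [Group Γ] [MulAction Γ M]

/-- A chart of `M` centred near `p ∈ N` in which the `Γ`-invariant subset `N` is a linear subspace
and the orbits in `N` are parallel linear subspaces. -/
structure AdaptedChart (N : SubMulAction Γ M) (l d : ℕ) (K C : Type*)
    [NormedAddCommGroup K] [NormedSpace ℝ K] [NormedAddCommGroup C] [NormedSpace ℝ C] (p : N) where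
  lin : E ≃L[ℝ] (EuclideanSpace ℝ (Fin d) × K) × C
  lev : EuclideanSpace ℝ (Fin l) ≃L[ℝ] EuclideanSpace ℝ (Fin d) × K
  chart : OpenPartialHomeomorph M E
  mem_source : (p : M) ∈ chart.source
  mem_maximalAtlas : chart ∈ IsManifold.maximalAtlas 𝓘(ℝ, E) ∞ M
  mem_iff : ∀ y ∈ chart.source, y ∈ N ↔ (lin (chart y)).2 = 0
  orbit_iff : ∀ y y' : N, (y : M) ∈ chart.source → (y' : M) ∈ chart.source →
    ((lin (chart y)).1.1 = (lin (chart y')).1.1 ↔ MulAction.orbitRel Γ N y y')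

namespace AdaptedChart

variable {N : SubMulAction Γ M} {l d : ℕ} {K C : Type*}
    [NormedAddCommGroup K] [NormedSpace ℝ K] [NormedAddCommGroup C] [NormedSpace ℝ C] {p q : N}
    (a : AdaptedChart (E := E) N l d K C p) (b : AdaptedChart (E := E) N l d K C q)

/-- The inclusion of the model of `N` in the model of `M`. -/
def incl : EuclideanSpace ℝ (Fin l) →L[ℝ] E :=
  (a.lin.symm : (EuclideanSpace ℝ (Fin d) × K) × C →L[ℝ] E) ∘L
    (ContinuousLinearMap.inl ℝ (EuclideanSpace ℝ (Fin d) × K) C) ∘L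
      (a.lev : EuclideanSpace ℝ (Fin l) →L[ℝ] EuclideanSpace ℝ (Fin d) × K)

/-- The projection of the model of `M` to the model of `N`. -/
def proj : E →L[ℝ] EuclideanSpace ℝ (Fin l) :=
  (a.lev.symm : EuclideanSpace ℝ (Fin d) × K →L[ℝ] EuclideanSpace ℝ (Fin l)) ∘L
    (ContinuousLinearMap.fst ℝ (EuclideanSpace ℝ (Fin d) × K) C) ∘L
      (a.lin : E →L[ℝ] (EuclideanSpace ℝ (Fin d) × K) × C)

lemma incl_apply (z : EuclideanSpace ℝ (Fin l)) : a.incl z = a.lin.symm (a.lev z, 0) := rfl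

lemma lev_proj (x : E) : a.lev (a.proj x) = (a.lin x).1 :=
  a.lev.apply_symm_apply _

lemma proj_incl (z : EuclideanSpace ℝ (Fin l)) : a.proj (a.incl z) = z := by
  apply a.lev.injective
  rw [lev_proj, incl_apply, a.lin.apply_symm_apply]

lemma incl_proj {x : E} (hx : (a.lin x).2 = 0) : a.incl (a.proj x) = x := by
  rw [incl_apply, lev_proj, ← hx, Prod.mk.eta, a.lin.symm_apply_apply]

lemma symm_incl_mem {z : EuclideanSpace ℝ (Fin l)} (hz : a.incl z ∈ a.chart.target) :
    a.chart.symm (a.incl z) ∈ N := by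
  rw [a.mem_iff _ (a.chart.map_target hz), a.chart.right_inv hz, incl_apply,
    a.lin.apply_symm_apply]

open Classical in
/-- The inverse of the chart of `N` induced by an adapted chart of `M`. -/
def levelInv (z : EuclideanSpace ℝ (Fin l)) : N :=
  -- Outside the target the value is irrelevant; `p` merely witnesses that `N` is nonempty.
  if h : a.incl z ∈ a.chart.target then ⟨_, a.symm_incl_mem h⟩ else p

lemma coe_levelInv {z : EuclideanSpace ℝ (Fin l)} (hz : a.incl z ∈ a.chart.target) :
    (a.levelInv z : M) = a.chart.symm (a.incl z) := by
  rw [levelInv, dif_pos hz]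

/-- The chart of `N` induced by an adapted chart of `M`. -/
def levelChart : OpenPartialHomeomorph N (EuclideanSpace ℝ (Fin l)) where
  toFun y := a.proj (a.chart y)
  invFun := a.levelInv
  source := Subtype.val ⁻¹' a.chart.source
  target := a.incl ⁻¹' a.chart.target
  map_source' := by
    intro y hy
    rw [mem_preimage, a.incl_proj ((a.mem_iff _ hy).1 y.2)]
    exact a.chart.map_source hy
  map_target' := by
    intro z hz
    rw [mem_preimage, a.coe_levelInv hz]
    exact a.chart.map_target hz
  left_inv' := by
    intro y hy
    have h : a.incl (a.proj (a.chart y)) = a.chart y := a.incl_proj ((a.mem_iff _ hy).1 y.2)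
    have h' : a.chart y ∈ a.chart.target := a.chart.map_source hy
    apply Subtype.ext
    rw [a.coe_levelInv (h.symm ▸ h'), h, a.chart.left_inv hy]
  right_inv' := by
    intro z hz
    rw [a.coe_levelInv hz, a.chart.right_inv hz, proj_incl]
  open_source := a.chart.open_source.preimage continuous_subtype_val
  open_target := a.chart.open_target.preimage a.incl.continuous
  continuousOn_toFun := a.proj.continuous.comp_continuousOn
    (a.chart.continuousOn.comp continuous_subtype_val.continuousOn fun _ h => h)
  continuousOn_invFun := by
    rw [Topology.IsInducing.subtypeVal.continuousOn_iff]
    exact (a.chart.continuousOn_symm.comp a.incl.continuous.continuousOn fun _ h => h).congr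
      fun z hz => a.coe_levelInv hz

lemma mem_levelChart_source {y : N} : y ∈ a.levelChart.source ↔ (y : M) ∈ a.chart.source :=
  Iff.rfl

lemma levelChart_apply (y : N) : a.levelChart y = a.proj (a.chart y) := rfl

lemma coe_levelChart_symm {z : EuclideanSpace ℝ (Fin l)} (hz : z ∈ a.levelChart.target) :
    (a.levelChart.symm z : M) = a.chart.symm (a.incl z) :=
  a.coe_levelInv hz

lemma levelChart_orbit_iff (y : N) (hy : y ∈ a.levelChart.source) (y' : N)
    (hy' : y' ∈ a.levelChart.source) :
    (a.lev (a.levelChart y)).1 = (a.lev (a.levelChart y')).1 ↔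
      (Quotient.mk _ y : MulAction.orbitRel.Quotient Γ N) = Quotient.mk _ y' := by
  rw [levelChart_apply, levelChart_apply, lev_proj, lev_proj, a.orbit_iff y y' hy hy']
  exact Quotient.eq.symm

/-- A general `f` is allowed in the middle: level charts use the identity, orbit charts use the
action of a group element. -/
lemma contDiffAt_transition {f : M → M} (hf : ContMDiff 𝓘(ℝ, E) 𝓘(ℝ, E) ∞ f) {x : E}
    (hx : x ∈ a.chart.target) (hfx : f (a.chart.symm x) ∈ b.chart.source) :
    ContDiffAt ℝ ∞ (fun x => b.chart (f (a.chart.symm x))) x := by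
  rw [← contMDiffAt_iff_contDiffAt]
  exact (contMDiffAt_of_mem_maximalAtlas b.mem_maximalAtlas hfx).comp x
    (hf.contMDiffAt.comp x (contMDiffAt_symm_of_mem_maximalAtlas a.mem_maximalAtlas hx))

lemma contDiffOn_levelChart :
    ContDiffOn ℝ ∞ (a.levelChart.symm ≫ₕ b.levelChart)
      (a.levelChart.symm ≫ₕ b.levelChart).source := by
  intro z hz
  obtain ⟨hz₁, hz₂⟩ : z ∈ a.levelChart.target ∧ a.levelChart.symm z ∈ b.levelChart.source := by
    simpa using hz
  have hz₂' : a.chart.symm (a.incl z) ∈ b.chart.source := by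
    rw [← a.coe_levelChart_symm hz₁]
    exact hz₂
  have h1 := a.contDiffAt_transition b contMDiff_id (x := a.incl z) hz₁ hz₂'
  have h2 : ContDiffAt ℝ ∞ (fun z => b.proj (b.chart (a.chart.symm (a.incl z)))) z :=
    b.proj.contDiff.contDiffAt.comp z (h1.comp z a.incl.contDiff.contDiffAt)
  refine (h2.congr_of_eventuallyEq ?_).contDiffWithinAt
  filter_upwards [a.levelChart.open_target.mem_nhds hz₁] with w hw
  change b.proj (b.chart (a.levelChart.symm w)) = _
  rw [a.coe_levelChart_symm hw]

lemma continuous_quotient_mk :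
    Continuous (Quotient.mk _ : N → MulAction.orbitRel.Quotient Γ N) :=
  continuous_quotient_mk'

lemma isOpenMap_quotient_mk [ContinuousConstSMul Γ N] :
    IsOpenMap (Quotient.mk _ : N → MulAction.orbitRel.Quotient Γ N) :=
  isOpenMap_quotient_mk'_mul

variable [ContinuousConstSMul Γ N]

/-- The chart of the orbit space of `N` induced by an adapted chart of `M`. -/
def orbitChart :
    OpenPartialHomeomorph (MulAction.orbitRel.Quotient Γ N) (EuclideanSpace ℝ (Fin d)) :=
  quotientChart continuous_quotient_mk isOpenMap_quotient_mk a.levelChart_orbit_iff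

lemma mem_orbitChart_source {y : N} (hy : y ∈ a.levelChart.source) :
    (Quotient.mk _ y : MulAction.orbitRel.Quotient Γ N) ∈ a.orbitChart.source :=
  ⟨y, hy, rfl⟩

lemma orbitChart_apply {y : N} (hy : y ∈ a.levelChart.source) :
    a.orbitChart (Quotient.mk _ y : MulAction.orbitRel.Quotient Γ N) =
      (a.lev (a.levelChart y)).1 :=
  quotientChartFun_apply a.levelChart_orbit_iff hy

lemma orbitChart_symm_apply {s : EuclideanSpace ℝ (Fin d)} {v : K}
    (hv : a.lev.symm (s, v) ∈ a.levelChart.target) :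
    a.orbitChart.symm s = Quotient.mk _ (a.levelChart.symm (a.lev.symm (s, v))) :=
  quotientChartInv_apply a.levelChart_orbit_iff hv

/-- The two charts may meet the same orbit at different points, related by some `γ`. Near `s₀` this
one `γ` moves a slice of the first chart, with `K`-coordinate held fixed, into the second, so the
transition map is `γ` read in coordinates. -/
lemma contDiffOn_orbitChart
    (hΓ : ∀ γ : Γ, ContMDiff 𝓘(ℝ, E) 𝓘(ℝ, E) ∞ fun x : M => γ • x) :
    ContDiffOn ℝ ∞ (a.orbitChart.symm ≫ₕ b.orbitChart)
      (a.orbitChart.symm ≫ₕ b.orbitChart).source := by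
  intro s₀ hs₀
  obtain ⟨hs₁, hs₂⟩ : s₀ ∈ a.orbitChart.target ∧ a.orbitChart.symm s₀ ∈ b.orbitChart.source := by
    simpa using hs₀
  obtain ⟨_, ⟨z, hz, rfl⟩, rfl⟩ := hs₁
  have hz' : a.lev.symm ((a.lev z).1, (a.lev z).2) ∈ a.levelChart.target := by simpa using hz
  rw [a.orbitChart_symm_apply hz'] at hs₂
  obtain ⟨y', hy', hyy'⟩ := hs₂
  obtain ⟨γ, hγ⟩ : MulAction.orbitRel Γ N y' _ := Quotient.exact hyy'
  -- the transition map is given by `γ` near `s₀`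
  let S : EuclideanSpace ℝ (Fin d) → EuclideanSpace ℝ (Fin l) :=
    fun s => a.lev.symm (s, (a.lev z).2)
  have hS : ContDiff ℝ ∞ S := a.lev.symm.contDiff.comp (contDiff_prodMk_left _)
  have hγS : γ • a.chart.symm (a.incl (S (a.lev z).1)) ∈ b.chart.source := by
    have h1 : ((γ • a.levelChart.symm (S (a.lev z).1) : N) : M) ∈ b.chart.source := by
      have h2 : γ • a.levelChart.symm (S (a.lev z).1) = y' := hγ
      rw [h2]
      exact hy'
    rwa [SubMulAction.val_smul, a.coe_levelChart_symm hz'] at h1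
  have h1 := a.contDiffAt_transition b (hΓ γ) (x := a.incl (S (a.lev z).1)) hz' hγS
  have h2 : ContDiffAt ℝ ∞ (fun s => (b.lev (b.proj (b.chart (γ • a.chart.symm (a.incl (S s)))))).1)
      (a.lev z).1 :=
    (contDiff_fst.comp (b.lev.contDiff.comp b.proj.contDiff)).contDiffAt.comp _
      (ContDiffAt.comp (g := fun x => b.chart (γ • a.chart.symm x)) _ h1
        (a.incl.contDiff.comp hS).contDiffAt)
  refine (h2.congr_of_eventuallyEq ?_).contDiffWithinAt
  have hcont : ContinuousAt (fun s => γ • a.levelChart.symm (S s)) (a.lev z).1 :=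
    (continuous_const_smul γ).continuousAt.comp
      (ContinuousAt.comp (g := a.levelChart.symm) (a.levelChart.continuousAt_symm hz')
        hS.continuous.continuousAt)
  have hmem : γ • a.levelChart.symm (S (a.lev z).1) ∈ b.levelChart.source := by
    rw [mem_levelChart_source, SubMulAction.val_smul, a.coe_levelChart_symm hz']
    exact hγS
  filter_upwards [(a.levelChart.open_target.preimage hS.continuous).mem_nhds hz',
    hcont (b.levelChart.open_source.mem_nhds hmem)] with s hs hs'
  change b.orbitChart (a.orbitChart.symm s) = _
  have h3 : (Quotient.mk _ (a.levelChart.symm (S s)) : MulAction.orbitRel.Quotient Γ N) =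
      Quotient.mk _ (γ • a.levelChart.symm (S s)) :=
    Quotient.sound ⟨γ⁻¹, by simp⟩
  rw [a.orbitChart_symm_apply hs, h3, b.orbitChart_apply hs', levelChart_apply,
    SubMulAction.val_smul, a.coe_levelChart_symm hs]

end AdaptedChart

end AdaptedChart

/-! ### Smooth structures on the subset and on its orbit space -/

section AdaptedAtlas

variable {E : Type*} [NormedAddCommGroup E] [NormedSpace ℝ E]
  {M : Type*} [TopologicalSpace M] [ChartedSpace E M]
  {Γ : Type*} [Group Γ] [MulAction Γ M] {N : SubMulAction Γ M} {l d : ℕ} {K C : Type*}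
  [NormedAddCommGroup K] [NormedSpace ℝ K] [NormedAddCommGroup C] [NormedSpace ℝ C]
  (a : ∀ p : N, AdaptedChart (E := E) N l d K C p)

/-- The charted space structure on `N` given by adapted charts. -/
abbrev levelChartedSpace : ChartedSpace (EuclideanSpace ℝ (Fin l)) N where
  atlas := range fun p => (a p).levelChart
  chartAt p := (a p).levelChart
  mem_chart_source p := (a p).mem_source
  chart_mem_atlas p := mem_range_self p

lemma isManifold_level :
    letI := levelChartedSpace a
    IsManifold (𝓡 l) ∞ N := by
  let _ := levelChartedSpace a
  refine isManifold_of_contDiffOn (𝓡 l) ∞ N ?_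
  rintro _ _ ⟨p, rfl⟩ ⟨q, rfl⟩
  simpa using! (a p).contDiffOn_levelChart (a q)

/-- In adapted charts the inclusion is the linear map `z ↦ (z, 0)`. -/
lemma isSmoothEmbedding_level [IsManifold 𝓘(ℝ, E) ∞ M] :
    letI := levelChartedSpace a
    Manifold.IsSmoothEmbedding (𝓡 l) 𝓘(ℝ, E) ∞ (Subtype.val : N → M) := by
  let _ := levelChartedSpace a
  have := isManifold_level a
  refine ⟨Manifold.IsImmersionOfComplement.isImmersion (F := C) fun p => ?_, .subtypeVal⟩
  refine Manifold.IsImmersionAtOfComplement.mk_of_charts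
    (((a p).lev.prodCongr (ContinuousLinearEquiv.refl ℝ C)).trans (a p).lin.symm)
    (a p).levelChart (a p).chart (a p).mem_source (a p).mem_source
    (IsManifold.chart_mem_maximalAtlas p) (a p).mem_maximalAtlas (fun _ h => h) ?_
  intro z hz
  have hz' : z ∈ (a p).levelChart.target := by simpa using! hz
  change (a p).chart ((a p).levelChart.symm z) = (a p).incl z
  rw [(a p).coe_levelChart_symm hz', (a p).chart.right_inv hz']

variable [ContinuousConstSMul Γ N]

/-- The charted space structure on the orbit space of `N` given by adapted charts. -/
abbrev orbitChartedSpace :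
    ChartedSpace (EuclideanSpace ℝ (Fin d)) (MulAction.orbitRel.Quotient Γ N) where
  atlas := range fun p => (a p).orbitChart
  chartAt q := (a q.out).orbitChart
  mem_chart_source q := by
    have h := (a q.out).mem_orbitChart_source (y := q.out) (a q.out).mem_source
    rwa [Quotient.out_eq] at h
  chart_mem_atlas q := mem_range_self q.out

lemma isManifold_orbit (hΓ : ∀ γ : Γ, ContMDiff 𝓘(ℝ, E) 𝓘(ℝ, E) ∞ fun x : M => γ • x) :
    letI := orbitChartedSpace a
    IsManifold (𝓡 d) ∞ (MulAction.orbitRel.Quotient Γ N) := by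
  let _ := orbitChartedSpace a
  refine isManifold_of_contDiffOn (𝓡 d) ∞ (MulAction.orbitRel.Quotient Γ N) ?_
  rintro _ _ ⟨p, rfl⟩ ⟨q, rfl⟩
  simpa using! (a p).contDiffOn_orbitChart (a q) hΓ

/-- In adapted charts the projection is the linear map `(s, v) ↦ s`. -/
lemma isSubmersion_orbit (hΓ : ∀ γ : Γ, ContMDiff 𝓘(ℝ, E) 𝓘(ℝ, E) ∞ fun x : M => γ • x) :
    letI := levelChartedSpace a
    letI := orbitChartedSpace a
    Manifold.IsSubmersion (𝓡 l) (𝓡 d) ∞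
      (Quotient.mk _ : N → MulAction.orbitRel.Quotient Γ N) := by
  let _ := levelChartedSpace a
  let _ := orbitChartedSpace a
  have := isManifold_level a
  have := isManifold_orbit a hΓ
  refine Manifold.IsSubmersionOfComplement.isSubmersion (F := K) fun p => ?_
  refine Manifold.IsSubmersionAtOfComplement.mk_of_charts (a p).lev
    (a p).levelChart (a p).orbitChart (a p).mem_source
    ((a p).mem_orbitChart_source (a p).mem_source)
    (IsManifold.chart_mem_maximalAtlas p)
    (StructureGroupoid.subset_maximalAtlas _ (mem_range_self p))
    (fun _ h => (a p).mem_orbitChart_source h) ?_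
  intro z hz
  have hz' : z ∈ (a p).levelChart.target := by simpa using! hz
  change (a p).orbitChart (Quotient.mk _ ((a p).levelChart.symm z)) = ((a p).lev z).1
  rw [(a p).orbitChart_apply ((a p).levelChart.map_target hz'), (a p).levelChart.right_inv hz']

end AdaptedAtlas

/-! ### Proper actions and differentials in charts -/

section

/-- A proper action that is free at `p` moves a neighbourhood of `p` off itself, except for group
elements near `1`. -/
lemma exists_nhds_smul_mem_imp {Γ N : Type*} [Group Γ] [TopologicalSpace Γ] [TopologicalSpace N]
    [MulAction Γ N] [ProperSMul Γ N] {p : N} (hp : ∀ γ : Γ, γ • p = p → γ = 1) {O : Set Γ}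
    (hO : O ∈ 𝓝 1) : ∃ V ∈ 𝓝 p, ∀ γ : Γ, ∀ x ∈ V, γ • x ∈ V → γ ∈ O := by
  have hc := (ProperSMul.isProperMap_smul_pair (G := Γ) (X := N)).isClosedMap
  -- By freeness at `p` the fibre of `(γ, x) ↦ (γ • x, x)` over `(p, p)` is the single point `(1,
  -- p)`. Since the map is closed, fibres over nearby points stay in `O × N`.
  have h1 : ∀ᶠ z in 𝓝 (p, p), ∀ gx : Γ × N, (gx.1 • gx.2, gx.2) = z → gx.1 ∈ O := by
    refine hc.eventually_nhds_fiber (p := fun gx : Γ × N => gx.1 ∈ O) (p, p) ?_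
    rintro ⟨γ, x⟩ hγ
    obtain ⟨h2, h3⟩ := Prod.mk.inj hγ
    dsimp only at h2 h3
    subst h3
    rw [hp γ h2]
    exact continuous_fst.continuousAt.preimage_mem_nhds hO
  rw [nhds_prod_eq] at h1
  obtain ⟨V, hV, h⟩ := eventually_prod_self_iff'.1 h1
  exact ⟨V, hV, fun γ x hx hγ => h (γ • x) hγ x hx (γ, x) rfl⟩

/-- The centre `q` of the target chart is a separate variable because an orbit map sends `1` to `1 •
p`, which is only propositionally equal to `p`. -/
lemma hasFDerivAt_extChartAt_comp {E₁ E₂ M₁ M₂ : Type*} [NormedAddCommGroup E₁] [NormedSpace ℝ E₁]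
    [NormedAddCommGroup E₂] [NormedSpace ℝ E₂] [TopologicalSpace M₁] [ChartedSpace E₁ M₁]
    [TopologicalSpace M₂] [ChartedSpace E₂ M₂] {f : M₁ → M₂} {x : M₁} {f' : E₁ →L[ℝ] E₂}
    (h : HasMFDerivAt 𝓘(ℝ, E₁) 𝓘(ℝ, E₂) f x f') {q : M₂} (hq : f x = q) :
    HasFDerivAt (fun z => extChartAt 𝓘(ℝ, E₂) q (f ((extChartAt 𝓘(ℝ, E₁) x).symm z))) f'
      (extChartAt 𝓘(ℝ, E₁) x x) := by
  subst hq
  have h' : HasFDerivWithinAt (writtenInExtChartAt 𝓘(ℝ, E₁) 𝓘(ℝ, E₂) x f) f'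
    (range 𝓘(ℝ, E₁)) (extChartAt 𝓘(ℝ, E₁) x x) := h.2
  rwa [modelWithCornersSelf_coe, range_id, hasFDerivWithinAt_univ] at h'

/-! ### The momentum mapping and the isotropy group of `β` -/

section Momentum

variable {E : Type*} [NormedAddCommGroup E] [NormedSpace ℝ E]
  {M : Type*} [TopologicalSpace M] [ChartedSpace E M]
  {F : Type*} [NormedAddCommGroup F] [NormedSpace ℝ F]
  {G : Type*} [TopologicalSpace G] [ChartedSpace F G] [Group G] [MulAction G M]

/-- The differential of a map to the dual of the Lie algebra, on the model space. -/
def momentDeriv (E : Type*) [NormedAddCommGroup E] [NormedSpace ℝ E]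
    {M : Type*} [TopologicalSpace M] [ChartedSpace E M] (μ : M → LieDual F) (x : M) :
    E →L[ℝ] LieDual F :=
  mfderiv 𝓘(ℝ, E) 𝓘(ℝ, LieDual F) μ x

variable (E F G) in
/-- The differential at `1` of an orbit map, on the model space. -/
def orbitDeriv (x : M) : F →L[ℝ] E :=
  mfderiv 𝓘(ℝ, F) 𝓘(ℝ, E) (fun a : G => a • x) 1

variable (G) in
/-- The Lie algebra of the isotropy subgroup of `β` under the coadjoint action. -/
def coadjointIsotropyLie (β : LieDual F) : Submodule ℝ F :=
  LinearMap.ker (momentDeriv F (fun a : G => β ∘L Ad a⁻¹) 1 : F →ₗ[ℝ] LieDual F)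

lemma contMDiff_orbitMap [ContMDiffSMul 𝓘(ℝ, F) 𝓘(ℝ, E) ∞ G M] (x : M) :
    ContMDiff 𝓘(ℝ, F) 𝓘(ℝ, E) ∞ fun a : G => a • x :=
  (contMDiff_smul (I := 𝓘(ℝ, F)) (I' := 𝓘(ℝ, E))).comp (contMDiff_id.prodMk contMDiff_const)

variable (E F) in
lemma contMDiff_const_smul [ContMDiffSMul 𝓘(ℝ, F) 𝓘(ℝ, E) ∞ G M] (a : G) :
    ContMDiff 𝓘(ℝ, E) 𝓘(ℝ, E) ∞ fun x : M => a • x :=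
  (contMDiff_smul (I := 𝓘(ℝ, F)) (I' := 𝓘(ℝ, E))).comp (contMDiff_const.prodMk contMDiff_id)

lemma hasMFDerivAt_orbitMap [ContMDiffSMul 𝓘(ℝ, F) 𝓘(ℝ, E) ∞ G M] (x : M) :
    HasMFDerivAt 𝓘(ℝ, F) 𝓘(ℝ, E) (fun a : G => a • x) 1 (orbitDeriv E F G x) :=
  ((contMDiff_orbitMap x).contMDiffAt.mdifferentiableAt (by simp)).hasMFDerivAt

variable [IsManifold 𝓘(ℝ, E) ∞ M] {Ω : SymplecticForm E M} {μ : M → LieDual F}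

namespace IsHamiltonianAction

lemma map_smul (hμ : IsHamiltonianAction G Ω μ) (a : G) (x : M) : μ (a • x) = μ x ∘L Ad a⁻¹ :=
  ContinuousLinearMap.ext fun ξ => hμ.equivariant a x ξ

lemma hasMFDerivAt (hμ : IsHamiltonianAction G Ω μ) (x : M) :
    HasMFDerivAt 𝓘(ℝ, E) 𝓘(ℝ, LieDual F) μ x (momentDeriv E μ x) :=
  (hμ.contMDiff.contMDiffAt.mdifferentiableAt (by simp)).hasMFDerivAt

/-- The action is locally free at a regular point of the momentum mapping. -/
lemma injective_orbitDeriv (hμ : IsHamiltonianAction G Ω μ) {p : M}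
    (hp : Function.Surjective (momentDeriv E μ p)) :
    Function.Injective (orbitDeriv E F G p) := by
  rw [injective_iff_map_eq_zero]
  intro ξ hξ
  rw [SeparatingDual.eq_zero_iff_forall_dual_eq_zero (R := ℝ)]
  intro f
  -- Every functional is `dμ_p(v)` for some `v`, and its value at `ξ` is `Ω(ξ_M(p), v)`, which
  -- vanishes with `ξ_M(p)`.
  obtain ⟨v, rfl⟩ := hp f
  refine (hμ.momentum ξ p v).trans ?_
  have h : infinitesimalGenerator E G ξ p = 0 := hξ
  rw [h, map_zero]
  rfl

lemma hasMFDerivAt_comp_orbitMap [ContMDiffSMul 𝓘(ℝ, F) 𝓘(ℝ, E) ∞ G M]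
    (hμ : IsHamiltonianAction G Ω μ) (p : M) :
    HasMFDerivAt 𝓘(ℝ, F) 𝓘(ℝ, LieDual F) (fun a : G => μ (a • p)) 1
      (momentDeriv E μ p ∘L orbitDeriv E F G p) := by
  have h1 : HasMFDerivAt 𝓘(ℝ, E) 𝓘(ℝ, LieDual F) μ ((1 : G) • p) (momentDeriv E μ p) := by
    rw [one_smul]
    exact hμ.hasMFDerivAt p
  exact HasMFDerivAt.comp (1 : G) h1 (hasMFDerivAt_orbitMap (E := E) (G := G) p)

variable {β : LieDual F}

/-- Equivariance identifies `a ↦ β ∘ Ad a⁻¹` with `a ↦ μ(a • p)`. The kernel of `dμ_p` on orbit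
directions is thus the same subspace for all `p` over `β`, which lets all slice charts share one
model. -/
lemma mem_coadjointIsotropyLie_iff [ContMDiffSMul 𝓘(ℝ, F) 𝓘(ℝ, E) ∞ G M]
    (hμ : IsHamiltonianAction G Ω μ) {p : M} (hp : μ p = β) (ξ : F) :
    ξ ∈ coadjointIsotropyLie G β ↔ momentDeriv E μ p (orbitDeriv E F G p ξ) = 0 := by
  have h : (fun a : G => β ∘L Ad a⁻¹) = fun a => μ (a • p) := by
    ext1 a
    rw [hμ.map_smul, hp]
  rw [coadjointIsotropyLie, LinearMap.mem_ker, h, momentDeriv,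
    (hμ.hasMFDerivAt_comp_orbitMap p).mfderiv]
  rfl

variable [LieGroup 𝓘(ℝ, F) ∞ G]

lemma mem_coadjointIsotropy_iff (hμ : IsHamiltonianAction G Ω μ) {p : M} (hp : μ p = β) (a : G) :
    a ∈ coadjointIsotropy G β ↔ μ (a • p) = β := by
  rw [hμ.map_smul, hp]
  exact ⟨fun h => ContinuousLinearMap.ext h, fun h ξ => congrArg (fun T : LieDual F => T ξ) h⟩

lemma map_smul_eq_iff (hμ : IsHamiltonianAction G Ω μ) {a : G} (ha : a ∈ coadjointIsotropy G β)
    (x : M) : μ (a • x) = β ↔ μ x = β :=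
  (levelSet hμ β).smul_mem_iff' (⟨a, ha⟩ : coadjointIsotropy G β)

/-- The isotropy subgroup of `β` is parametrized near `1` by its Lie algebra. -/
theorem exists_coadjointIsotropy_parametrization [FiniteDimensional ℝ F]
    [ContMDiffSMul 𝓘(ℝ, F) 𝓘(ℝ, E) ∞ G M] (hμ : IsHamiltonianAction G Ω μ) {p : M} (hp : μ p = β) :
    ∃ (σ : coadjointIsotropyLie G β → F) (B : Set (coadjointIsotropyLie G β)),
      IsOpen B ∧ 0 ∈ B ∧ ContDiffOn ℝ ∞ σ B ∧ σ 0 = extChartAt 𝓘(ℝ, F) (1 : G) 1 ∧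
      (∀ v ∈ B, σ v ∈ (extChartAt 𝓘(ℝ, F) (1 : G)).target ∧
        (extChartAt 𝓘(ℝ, F) (1 : G)).symm (σ v) ∈ coadjointIsotropy G β) ∧
      HasFDerivAt σ (coadjointIsotropyLie G β).subtypeL 0 ∧
      ∀ O ∈ 𝓝 (0 : coadjointIsotropyLie G β), ∀ᶠ a in 𝓝 (1 : G), a ∈ coadjointIsotropy G β →
        ∃ v ∈ O, a = (extChartAt 𝓘(ℝ, F) (1 : G)).symm (σ v) := by
  set c := extChartAt 𝓘(ℝ, F) (1 : G) with hc
  let f : F → LieDual F := fun g => μ (c.symm g • p)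
  have hU : IsOpen c.target := isOpen_extChartAt_target 1
  have hcs : ContMDiffOn 𝓘(ℝ, F) 𝓘(ℝ, F) ∞ c.symm c.target := contMDiffOn_extChartAt_symm 1
  have hf : ContDiffOn ℝ ∞ f c.target := by
    rw [← contMDiffOn_iff_contDiffOn]
    exact hμ.contMDiff.comp_contMDiffOn ((contMDiff_orbitMap p).comp_contMDiffOn hcs)
  have hx₀ : c 1 ∈ c.target := mem_extChartAt_target 1
  let f' : F →L[ℝ] LieDual F := momentDeriv E μ p ∘L orbitDeriv E F G p
  have hφ : HasMFDerivAt 𝓘(ℝ, F) 𝓘(ℝ, LieDual F) (fun a : G => μ (a • p)) 1 f' :=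
    hμ.hasMFDerivAt_comp_orbitMap p
  have hf' : HasFDerivAt f f' (c 1) := hasFDerivAt_extChartAt_comp hφ rfl
  have hfβ : f (c 1) = β := by
    change μ (c.symm (c 1) • p) = β
    rw [hc, extChartAt_to_inv, one_smul, hp]
  have hrank : ∀ x ∈ c.target, ∃ (T : LieDual F →L[ℝ] LieDual F) (S : F →L[ℝ] F),
      HasFDerivAt f (T ∘L f' ∘L S) x := by
    intro x hx
    let a := c.symm x
    -- Constant rank comes from `μ(b • p) = μ((a⁻¹ b) • p) ∘ Ad a⁻¹`: the differential at `a` is the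
    -- one at `1`, preceded by that of a left translation and followed by the linear map `T`.
    let T : LieDual F →L[ℝ] LieDual F := (ContinuousLinearMap.compL ℝ F F ℝ).flip (Ad a⁻¹)
    have hT : ∀ y, f y = T (μ ((a⁻¹ * c.symm y) • p)) := by
      intro y
      change _ = μ ((a⁻¹ * c.symm y) • p) ∘L Ad a⁻¹
      rw [← hμ.map_smul, smul_smul, mul_inv_cancel_left]
    let ψ : F → G := fun y => a⁻¹ * c.symm y
    have hψ : MDifferentiableAt 𝓘(ℝ, F) 𝓘(ℝ, F) ψ x :=
      ((contMDiff_mul_left (I := 𝓘(ℝ, F)) (n := ∞) (a := a⁻¹)).contMDiffAt.comp x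
        (hcs.contMDiffAt (hU.mem_nhds hx))).mdifferentiableAt (by simp)
    have hψx : ψ x = 1 := inv_mul_cancel a
    have hφ' : HasMFDerivAt 𝓘(ℝ, F) 𝓘(ℝ, LieDual F) (fun a : G => μ (a • p)) (ψ x) f' := by
      have : ∀ b : G, b = 1 →
          HasMFDerivAt 𝓘(ℝ, F) 𝓘(ℝ, LieDual F) (fun a : G => μ (a • p)) b f' := by
        rintro b rfl
        exact hφ
      exact this _ hψx
    have h1 := (HasMFDerivAt.comp x hφ' hψ.hasMFDerivAt).hasFDerivAt
    refine ⟨T, mfderiv 𝓘(ℝ, F) 𝓘(ℝ, F) ψ x, ?_⟩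
    exact (T.hasFDerivAt.comp x h1).congr_of_eventuallyEq (Eventually.of_forall hT)
  obtain ⟨σ, B, hB, hB0, hσ, hσ0, hσf, hσ', hlev⟩ := exists_levelSet_parametrization hU hf hx₀ hf'
    hrank (coadjointIsotropyLie G β) (hμ.mem_coadjointIsotropyLie_iff hp)
  refine ⟨σ, B, hB, hB0, hσ, hσ0, fun v hv => ⟨(hσf v hv).1, ?_⟩, hσ', fun O hO => ?_⟩
  · rw [hμ.mem_coadjointIsotropy_iff hp]
    exact (hσf v hv).2.trans hfβ
  · filter_upwards [(continuousAt_extChartAt (I := 𝓘(ℝ, F)) (1 : G)).eventually (hlev O hO),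
      extChartAt_source_mem_nhds (I := 𝓘(ℝ, F)) (1 : G)] with a ha has haβ
    have h1 : f (c a) = f (c 1) := by
      rw [hfβ]
      change μ (c.symm (c a) • p) = β
      rw [c.left_inv has, ← hμ.mem_coadjointIsotropy_iff hp]
      exact haβ
    obtain ⟨v, hv, hav⟩ := ha h1
    exact ⟨v, hv, by rw [← hav, c.left_inv has]⟩

end IsHamiltonianAction

end Momentum

end

/-! ### Slice charts on the manifold -/

section SliceChart

variable {E : Type*} [NormedAddCommGroup E] [NormedSpace ℝ E] [FiniteDimensional ℝ E]
  {M : Type*} [TopologicalSpace M] [ChartedSpace E M] [IsManifold 𝓘(ℝ, E) ∞ M]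
  {F : Type*} [NormedAddCommGroup F] [NormedSpace ℝ F] [FiniteDimensional ℝ F]
  {G : Type*} [TopologicalSpace G] [ChartedSpace F G] [Group G] [LieGroup 𝓘(ℝ, F) ∞ G]
  [MulAction G M] [ContMDiffSMul 𝓘(ℝ, F) 𝓘(ℝ, E) ∞ G M]
  {Ω : SymplecticForm E M} {μ : M → LieDual F} {β : LieDual F}

namespace IsHamiltonianAction

-- The orbit map embeds the isotropy Lie algebra into `ker dμ_p`, whose dimension is `dim E - dim
-- 𝔤*`. Hence no truncation occurs in the natural-number subtractions that define the dimensions of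
-- the level set and of the quotient.
omit [FiniteDimensional ℝ F] [LieGroup 𝓘(ℝ, F) ∞ G] in
lemma finrank_isotropyLie_add_le (hμ : IsHamiltonianAction G Ω μ) {p : M} (hp : μ p = β)
    (hreg : Function.Surjective (momentDeriv E μ p)) :
    Module.finrank ℝ (coadjointIsotropyLie G β) + Module.finrank ℝ (LieDual F) ≤
      Module.finrank ℝ E := by
  let Z := LinearMap.ker (momentDeriv E μ p : E →ₗ[ℝ] LieDual F)
  have h : Module.finrank ℝ (LinearMap.range (momentDeriv E μ p : E →ₗ[ℝ] LieDual F)) +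
      Module.finrank ℝ Z = _ :=
        (momentDeriv E μ p : E →ₗ[ℝ] LieDual F).finrank_range_add_finrank_ker
  rw [LinearMap.range_eq_top.2 hreg, finrank_top] at h
  let δK : coadjointIsotropyLie G β →ₗ[ℝ] Z :=
    ((orbitDeriv E F G p : F →ₗ[ℝ] E).comp (coadjointIsotropyLie G β).subtype).codRestrict Z
      fun ξ => (hμ.mem_coadjointIsotropyLie_iff hp _).1 ξ.2
  have hδK : Function.Injective δK := fun a b hab =>
    Subtype.ext (hμ.injective_orbitDeriv hreg (congrArg Subtype.val hab))
  have := LinearMap.finrank_le_finrank_of_injective hδK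
  omega

/-- Near a regular point, the level set and the orbits of the isotropy group in it are
straightened by a chart. -/
theorem exists_sliceChart (hμ : IsHamiltonianAction G Ω μ) {p : M} (hp : μ p = β)
    (hreg : Function.Surjective (momentDeriv E μ p)) {d : ℕ}
    (hd : d + Module.finrank ℝ (coadjointIsotropyLie G β) + Module.finrank ℝ (LieDual F) =
      Module.finrank ℝ E) :
    ∃ (α : coadjointIsotropyLie G β → G) (t : EuclideanSpace ℝ (Fin d) → M)
      (θ : OpenPartialHomeomorph M
        ((EuclideanSpace ℝ (Fin d) × coadjointIsotropyLie G β) × LieDual F)),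
      p ∈ θ.source ∧ θ p = 0 ∧
      ContMDiffOn 𝓘(ℝ, E)
        𝓘(ℝ, (EuclideanSpace ℝ (Fin d) × coadjointIsotropyLie G β) × LieDual F) ∞ θ θ.source ∧
      ContMDiffOn 𝓘(ℝ, (EuclideanSpace ℝ (Fin d) × coadjointIsotropyLie G β) × LieDual F)
        𝓘(ℝ, E) ∞ θ.symm θ.target ∧
      (∀ z ∈ θ.target, μ (θ.symm z) = β ↔ z.2 = 0) ∧
      (∀ s v, ((s, v), 0) ∈ θ.target → α v ∈ coadjointIsotropy G β ∧
        θ.symm ((s, v), 0) = α v • t s) ∧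
      α 0 = 1 ∧ t 0 = p ∧ ContinuousAt t 0 ∧
      ∀ O ∈ 𝓝 (0 : coadjointIsotropyLie G β), ∀ᶠ a in 𝓝 (1 : G), a ∈ coadjointIsotropy G β →
        ∃ v ∈ O, a = α v := by
  set K := coadjointIsotropyLie G β
  let D := EuclideanSpace ℝ (Fin d)
  obtain ⟨σ, B, hB, hB0, hσ, hσ0, hσH, hσ', hlev⟩ :=
    hμ.exists_coadjointIsotropy_parametrization hp
  set c := extChartAt 𝓘(ℝ, F) (1 : G) with hc
  set k := extChartAt 𝓘(ℝ, E) p with hk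
  have hcs : ContMDiffOn 𝓘(ℝ, F) 𝓘(ℝ, F) ∞ c.symm c.target := contMDiffOn_extChartAt_symm 1
  have hks : ContMDiffOn 𝓘(ℝ, E) 𝓘(ℝ, E) ∞ k.symm k.target := contMDiffOn_extChartAt_symm p
  have hkm : ContMDiffOn 𝓘(ℝ, E) 𝓘(ℝ, E) ∞ k k.source := by
    rw [hk, extChartAt_source]
    exact contMDiffOn_extChartAt
  have hct : IsOpen c.target := isOpen_extChartAt_target 1
  have hkt : IsOpen k.target := isOpen_extChartAt_target p
  have hkso : IsOpen k.source := isOpen_extChartAt_source p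
  have hc1 : c.symm (c 1) = 1 := extChartAt_to_inv 1
  have hkp : k.symm (k p) = p := extChartAt_to_inv p
  -- the action in coordinates
  let S : F × E → M := fun z => c.symm z.1 • k.symm z.2
  have hS : ContMDiffOn 𝓘(ℝ, F × E) 𝓘(ℝ, E) ∞ S (c.target ×ˢ k.target) := by
    refine (contMDiff_smul (I := 𝓘(ℝ, F)) (I' := 𝓘(ℝ, E)) (n := ∞)).comp_contMDiffOn
      (ContMDiffOn.prodMk ?_ ?_)
    · exact hcs.comp contDiff_fst.contMDiff.contMDiffOn fun z hz => hz.1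
    · exact hks.comp contDiff_snd.contMDiff.contMDiffOn fun z hz => hz.2
  let W : Set (F × E) := c.target ×ˢ k.target ∩ S ⁻¹' k.source
  have hW : IsOpen W := hS.continuousOn.isOpen_inter_preimage (hct.prod hkt) hkso
  have hSp : S (c 1, k p) = p := by
    change c.symm (c 1) • k.symm (k p) = p
    rw [hc1, hkp, one_smul]
  have hW0 : (c 1, k p) ∈ W := by
    refine ⟨⟨mem_extChartAt_target 1, mem_extChartAt_target p⟩, ?_⟩
    rw [mem_preimage, hSp]
    exact mem_extChartAt_source p
  let A : F × E → E := fun z => k (S z)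
  have hA : ContDiffOn ℝ ∞ A W := by
    rw [← contMDiffOn_iff_contDiffOn]
    exact hkm.comp (hS.mono inter_subset_left) fun z hz => hz.2
  have hA1 : ∀ x, (c 1, x) ∈ W → A (c 1, x) = x := by
    intro x hx
    change k (c.symm (c 1) • k.symm x) = x
    rw [hc1, one_smul, k.right_inv hx.1.2]
  have hδ : HasFDerivAt (fun g => A (g, k p)) (orbitDeriv E F G p) (c 1) := by
    have h := hasFDerivAt_extChartAt_comp (hasMFDerivAt_orbitMap (E := E) (F := F) (G := G) p)
      (one_smul G p)
    refine h.congr_of_eventuallyEq (Eventually.of_forall fun g => ?_)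
    change k (c.symm g • k.symm (k p)) = k (c.symm g • p)
    rw [hkp]
  have hm : ContDiffOn ℝ ∞ (fun x => μ (k.symm x)) k.target := by
    rw [← contMDiffOn_iff_contDiffOn]
    exact hμ.contMDiff.comp_contMDiffOn hks
  have hm' : HasFDerivAt (fun x => μ (k.symm x)) (momentDeriv E μ p) (k p) :=
    hasFDerivAt_extChartAt_comp (hμ.hasMFDerivAt p) rfl
  obtain ⟨τ, B', hB', hτ, hτX, hτ0, hτm, e, he0, heW, hef, hes, hesymm⟩ :=
    exists_slice hW hW0 hA hA1 hδ (hμ.injective_orbitDeriv hreg) hkt (mem_extChartAt_target p)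
      hm hm' hreg K (hμ.mem_coadjointIsotropyLie_iff hp) hB hB0 hσ hσ0 hσ' hd
  simp only [hkp, hp] at hτm
  have he0' : e 0 = k p := by
    rw [hef]
    change k (S (σ 0, τ 0)) = _
    rw [hσ0, hτ0, hSp]
  -- the chart
  let κ : OpenPartialHomeomorph M E := chartAt E p
  have hκ : ∀ x, κ x = k x := fun x => by simp [κ, hk]
  have hκs : κ.source = k.source := by simp [κ, hk]
  have hκt : κ.target = k.target := by simp [κ, hk]
  have hκsymm : ∀ x, κ.symm x = k.symm x := fun x => by simp [κ, hk]
  let θ : OpenPartialHomeomorph M ((D × K) × LieDual F) := κ ≫ₕ e.symm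
  have hθs : θ.source = κ.source ∩ κ ⁻¹' e.target := κ.trans_source e.symm
  have hθt : θ.target ⊆ e.source := fun z hz => by
    have : z ∈ e.source ∩ e ⁻¹' κ.target := by
      simpa [θ, OpenPartialHomeomorph.trans_target] using hz
    exact this.1
  have hθsymm : ∀ z ∈ θ.target, θ.symm z = c.symm (σ z.1.2) • k.symm (τ (z.1.1, z.2)) := by
    intro z hz
    change κ.symm (e z) = _
    rw [hκsymm, hef]
    exact k.left_inv (heW z (hθt hz)).2.2.2
  have hlevel : ∀ z ∈ θ.target, μ (θ.symm z) = β ↔ z.2 = 0 := by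
    intro z hz
    obtain ⟨h1, h2, h3⟩ := heW z (hθt hz)
    -- The group factor lies in `G_β` and does not affect membership in the level set, while `μ`
    -- takes the value `β + z.2` on the transversal.
    rw [hθsymm z hz, hμ.map_smul_eq_iff (hσH _ h1).2, hτm _ h2]
    exact add_eq_left
  refine ⟨fun v => c.symm (σ v), fun s => k.symm (τ (s, 0)), θ, ?_, ?_, ?_, ?_, hlevel, ?_, ?_, ?_,
    ?_, hlev⟩
  · rw [hθs]
    refine ⟨mem_chart_source E p, ?_⟩
    rw [mem_preimage, hκ, ← he0']
    exact e.map_source he0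
  · change e.symm (κ p) = 0
    rw [hκ, ← he0', e.left_inv he0]
  · rw [hθs]
    refine (contMDiffOn_iff_contDiffOn.2 hesymm).comp
      (t := e.target) ((contMDiffOn_chart (n := ∞)).mono inter_subset_left) fun x hx => hx.2
  · refine (contMDiffOn_chart_symm (I := 𝓘(ℝ, E)) (n := ∞) (x := p)).comp
      ((contMDiffOn_iff_contDiffOn.2 hes).mono hθt) fun z hz => ?_
    have : z ∈ e.source ∩ e ⁻¹' κ.target := by
      simpa [θ, OpenPartialHomeomorph.trans_target] using hz
    exact this.2
  · intro s v hz
    exact ⟨(hσH _ (heW _ (hθt hz)).1).2, hθsymm _ hz⟩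
  · change c.symm (σ 0) = 1
    rw [hσ0, hc1]
  · change k.symm (τ 0) = p
    rw [hτ0, hkp]
  · have h0B' : ((0 : D), (0 : LieDual F)) ∈ B' := (heW 0 he0).2.1
    have h1 : ContinuousAt τ ((0 : D), (0 : LieDual F)) :=
      hτ.continuousOn.continuousAt (hB'.mem_nhds h0B')
    have h2 : ContinuousAt (fun s : D => τ (s, 0)) 0 :=
      ContinuousAt.comp (g := τ) (f := fun s : D => (s, (0 : LieDual F))) h1
        (Continuous.prodMk_left _).continuousAt
    have h3 : ContinuousAt k.symm (τ ((0 : D), (0 : LieDual F))) :=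
      hks.continuousOn.continuousAt (hkt.mem_nhds (hτX h0B'))
    exact ContinuousAt.comp (g := k.symm) (f := fun s : D => τ (s, 0)) h3 h2

/-- If the isotropy group acts freely and properly on a regular level set, then there are charts
adapted to the level set and to the orbits in it. -/
theorem nonempty_adaptedChart (hμ : IsHamiltonianAction G Ω μ) (p : levelSet hμ β)
    (hreg : Function.Surjective (momentDeriv E μ (p : M))) (hfree : IsFreeOnLevel hμ β)
    [ProperSMul (coadjointIsotropy G β) (levelSet hμ β)] :
    Nonempty (AdaptedChart (E := E) (levelSet hμ β)
      (Module.finrank ℝ E - Module.finrank ℝ (LieDual F))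
      (Module.finrank ℝ E - Module.finrank ℝ (LieDual F) -
        Module.finrank ℝ (coadjointIsotropyLie G β))
      (coadjointIsotropyLie G β) (LieDual F) p) := by
  have hdim := hμ.finrank_isotropyLie_add_le p.2 hreg
  set l := Module.finrank ℝ E - Module.finrank ℝ (LieDual F) with hl
  set d := l - Module.finrank ℝ (coadjointIsotropyLie G β) with hd
  let K := coadjointIsotropyLie G β
  have hKf : Module.finrank ℝ K = Module.finrank ℝ (coadjointIsotropyLie G β) := rfl
  let D := EuclideanSpace ℝ (Fin d)
  have hDd : Module.finrank ℝ D = d := finrank_euclideanSpace_fin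
  obtain ⟨α, t, θ, hpθ, hθp, hθm, hθsm, hθβ, hθα, hα0, ht0, htc, hα⟩ :=
    hμ.exists_sliceChart p.2 hreg (d := d) (by omega)
  -- Any isomorphisms of the models serve here: the chart is defined as `lin⁻¹ ∘ θ`, so that only
  -- the slice coordinates `θ` matter.
  let lin : E ≃L[ℝ] (D × K) × LieDual F := ContinuousLinearEquiv.ofFinrankEq (by
    rw [Module.finrank_prod, Module.finrank_prod, hDd]
    omega)
  let lev : EuclideanSpace ℝ (Fin l) ≃L[ℝ] D × K := ContinuousLinearEquiv.ofFinrankEq (by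
    rw [Module.finrank_prod, hDd, finrank_euclideanSpace_fin]
    omega)
  -- a product neighbourhood in the slice coordinates
  have h0θ : (((0 : D), (0 : K)), (0 : LieDual F)) ∈ θ.target := by
    have := θ.map_source hpθ
    rwa [hθp] at this
  have hnhds : (fun z : D × K => ((z, 0) : (D × K) × LieDual F)) ⁻¹' θ.target ∈
      𝓝 ((0 : D), (0 : K)) :=
    (Continuous.prodMk_left _).continuousAt.preimage_mem_nhds (θ.open_target.mem_nhds h0θ)
  rw [nhds_prod_eq, mem_prod_iff] at hnhds
  obtain ⟨Os, hOs, O, hO, hOO⟩ := hnhds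
  have hO' : {γ : coadjointIsotropy G β | ∃ v ∈ O, (γ : G) = α v} ∈ 𝓝 1 := by
    have h1 : ∀ᶠ γ : coadjointIsotropy G β in 𝓝 1, ((γ : G) ∈ coadjointIsotropy G β →
        ∃ v ∈ O, (γ : G) = α v) :=
      (continuous_subtype_val.tendsto (1 : coadjointIsotropy G β)).eventually (hα O hO)
    filter_upwards [h1] with γ hγ
    exact hγ γ.2
  -- An element of `G_β` carrying a point of `V` into `V` equals `α v` with `v ∈ O`, which keeps it
  -- within reach of the slice coordinates.
  obtain ⟨V, hV, hVO⟩ := exists_nhds_smul_mem_imp (p := p) (fun γ => hfree γ p) hO'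
  rw [nhds_subtype_eq_comap, mem_comap] at hV
  obtain ⟨V', hV', hVV'⟩ := hV
  have hOt : t ⁻¹' V' ∈ 𝓝 (0 : D) := htc (by rwa [ht0])
  -- Only `s` is restricted, to keep the slice points `t s` in `V'`. No restriction on the group
  -- coordinate is needed, since each point of the chart in the level set is `a • t s` with `a` in
  -- `G_β`.
  obtain ⟨T, hTsub, hT, hT0⟩ := mem_nhds_iff.1 (inter_mem hOs hOt)
  let T' : Set ((D × K) × LieDual F) := (fun z => z.1.1) ⁻¹' T
  have hT' : IsOpen T' := hT.preimage (continuous_fst.comp continuous_fst)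
  let θ' : OpenPartialHomeomorph M ((D × K) × LieDual F) := (θ.symm.restrOpen T' hT').symm
  have hθ't : θ'.target = θ.target ∩ T' := rfl
  have hθ's : θ'.source = θ.source ∩ θ ⁻¹' T' := by
    simp [θ']
  let χ : OpenPartialHomeomorph M E := θ' ≫ₕ lin.symm.toHomeomorph.toOpenPartialHomeomorph
  have hχs : χ.source = θ.source ∩ θ ⁻¹' T' := by simp [χ, hθ's]
  have hχ : ∀ y, lin (χ y) = θ y := fun y => lin.apply_symm_apply _
  have hχβ : ∀ y ∈ χ.source, y ∈ levelSet hμ β ↔ (θ y).2 = 0 := by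
    intro y hy
    rw [hχs] at hy
    rw [← hθβ _ (θ.map_source hy.1), θ.left_inv hy.1]
    rfl
  -- the points of the slice
  have hslice : ∀ s ∈ T, t s ∈ levelSet hμ β ∧ t s ∈ V' ∧ ((s, 0), 0) ∈ θ.target ∧
      θ.symm ((s, 0), 0) = t s := by
    intro s hs
    have h1 : ((s, 0), 0) ∈ θ.target := hOO (mk_mem_prod (hTsub hs).1 (mem_of_mem_nhds hO))
    have h2 : θ.symm ((s, 0), 0) = t s := by rw [(hθα _ _ h1).2, hα0, one_smul]
    exact ⟨h2 ▸ (hθβ _ h1).2 rfl, (hTsub hs).2, h1, h2⟩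
  have hrep : ∀ y : levelSet hμ β, (y : M) ∈ χ.source → (θ y).1.1 ∈ T ∧
      ∃ a : coadjointIsotropy G β, (y : M) = a • t (θ y).1.1 ∧ (a : G) = α (θ y).1.2 := by
    intro y hy
    have h1 := (hχβ y hy).1 y.2
    rw [hχs] at hy
    have h2 : (((θ y).1.1, (θ y).1.2), 0) = θ y := by rw [← h1]
    have h3 : (((θ y).1.1, (θ y).1.2), 0) ∈ θ.target := h2 ▸ θ.map_source hy.1
    obtain ⟨h4, h5⟩ := hθα _ _ h3
    refine ⟨hy.2, ⟨_, h4⟩, ?_, rfl⟩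
    rw [h2, θ.left_inv hy.1] at h5
    exact h5
  refine ⟨⟨lin, lev, χ, ?_, ?_, ?_, ?_⟩⟩
  · rw [hχs]
    refine ⟨hpθ, ?_⟩
    rw [mem_preimage, hθp]
    exact hT0
  · refine OpenPartialHomeomorph.mem_maximalAtlas_of_contMDiffOn χ ?_ ?_
    · rw [hχs]
      exact lin.symm.contDiff.contMDiff.comp_contMDiffOn (hθm.mono inter_subset_left)
    · refine hθsm.comp lin.contDiff.contMDiff.contMDiffOn ?_
      intro z hz
      have : lin z ∈ θ'.target := by simpa [χ, OpenPartialHomeomorph.trans_target] using hz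
      exact this.1
  · intro y hy
    rw [hχβ y hy, hχ]
  · intro y y' hy hy'
    rw [hχ, hχ]
    obtain ⟨hs, a, ha, haα⟩ := hrep y hy
    obtain ⟨hs', a', ha', haα'⟩ := hrep y' hy'
    constructor
    · intro h
      refine ⟨a * a'⁻¹, Subtype.ext ?_⟩
      change (a * a'⁻¹) • (y' : M) = y
      rw [ha', smul_smul, inv_mul_cancel_right, ha, h]
    · rintro ⟨γ, hγ⟩
      have hγ' : γ • (y' : M) = y := congrArg Subtype.val hγ
      obtain ⟨h1, h2, h3, h4⟩ := hslice _ hs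
      obtain ⟨h1', h2', h3', h4'⟩ := hslice _ hs'
      -- After moving both points to the slice, the group element carries `t s'` to `t s`, both in
      -- `V'`, so it is `α v` with `v ∈ O`. Then `((s', v), 0)` and `((s, 0), 0)` are coordinates of
      -- one point, and injectivity of `θ.symm` gives `s' = s`.
      have h5 : (a⁻¹ * γ * a') • t (θ y').1.1 = t (θ y).1.1 := by
        rw [← smul_smul, ← ha', ← smul_smul, hγ', inv_smul_eq_iff]
        exact ha
      obtain ⟨v, hv, hav⟩ := hVO (a⁻¹ * γ * a') ⟨_, h1'⟩ (hVV' h2') (hVV' (by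
        rw [mem_preimage, SubMulAction.val_smul]
        change (a⁻¹ * γ * a') • t (θ y').1.1 ∈ V'
        rw [h5]
        exact h2))
      have h6 : (((θ y').1.1, v), 0) ∈ θ.target := hOO (mk_mem_prod (hTsub hs').1 hv)
      have h7 : θ.symm (((θ y').1.1, v), 0) = θ.symm (((θ y).1.1, 0), 0) := by
        rw [(hθα _ _ h6).2, ← hav, h4, ← h5]
        rfl
      have h8 := θ.symm.injOn h6 h3 h7
      exact (congrArg (fun z : (D × K) × LieDual F => z.1.1) h8).symm

end IsHamiltonianAction

end SliceChart

/-! ### The reduced manifold -/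

section

variable {E : Type*} [NormedAddCommGroup E] [NormedSpace ℝ E] [FiniteDimensional ℝ E]
  {M : Type*} [TopologicalSpace M] [SecondCountableTopology M] [ChartedSpace E M]
  [IsManifold 𝓘(ℝ, E) ∞ M]
  {F : Type*} [NormedAddCommGroup F] [NormedSpace ℝ F] [FiniteDimensional ℝ F]
  {G : Type*} [TopologicalSpace G] [ChartedSpace F G] [Group G] [LieGroup 𝓘(ℝ, F) ∞ G]
  [MulAction G M] [ContMDiffSMul 𝓘(ℝ, F) 𝓘(ℝ, E) ∞ G M]
  {Ω : SymplecticForm E M} {μ : M → LieDual F} {β : LieDual F}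

/-- The regular level set and the reduced space are smooth manifolds. -/
theorem nonempty_reducedManifold (hμ : IsHamiltonianAction G Ω μ) (hβ : IsRegularValue E μ β)
    (hfree : IsFreeOnLevel hμ β) (hproper : ProperSMul (coadjointIsotropy G β) (levelSet hμ β)) :
    Nonempty (ReducedManifold hμ β) := by
  have hΓ (γ : coadjointIsotropy G β) : ContMDiff 𝓘(ℝ, E) 𝓘(ℝ, E) ∞ fun x : M => γ • x :=
    contMDiff_const_smul E F (γ : G)
  let a (p : levelSet hμ β) := (hμ.nonempty_adaptedChart p (hβ p p.2) hfree).some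
  have : SecondCountableTopology (levelSet hμ β) :=
    TopologicalSpace.Subtype.secondCountableTopology _
  exact ⟨{
    levelDim := _
    reducedDim := _
    chartedLevel := levelChartedSpace a
    chartedReduced := orbitChartedSpace a
    isManifold_level := isManifold_level a
    isManifold_reduced := isManifold_orbit a hΓ
    t2Space_reduced := t2Space_quotient_mulAction_of_properSMul
    secondCountable_reduced := ContinuousConstSMul.secondCountableTopology
    isSmoothEmbedding_incl := isSmoothEmbedding_level a
    isSubmersion_proj := isSubmersion_orbit a hΓ }⟩

end

/-! ### Linear algebra of the quotient inner product -/

section PushMetric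

variable {V : Type*} [NormedAddCommGroup V] [NormedSpace ℝ V]
  {W : Type*} [NormedAddCommGroup W] [NormedSpace ℝ W]
  {V' : Type*} [NormedAddCommGroup V'] [NormedSpace ℝ V']
  {W' : Type*} [NormedAddCommGroup W'] [NormedSpace ℝ W']

/-- The inner product on `W` induced by the inner product `g` on `V` and the surjection
`A : V → W`: the inverse of the pushforward by `A` of the inner product dual to `g`. -/
def pushMetric (g : V →L[ℝ] V →L[ℝ] ℝ) (A : V →L[ℝ] W) : W →L[ℝ] W →L[ℝ] ℝ :=
  (A ∘L g.inverse ∘L (ContinuousLinearMap.compL ℝ V W ℝ).flip A).inverse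

variable {g : V →L[ℝ] V →L[ℝ] ℝ} {A : V →L[ℝ] W}

lemma isInvertible_of_injective [FiniteDimensional ℝ V] [FiniteDimensional ℝ W]
    (h : Module.finrank ℝ V = Module.finrank ℝ W) (hA : Function.Injective A) :
    A.IsInvertible :=
  ⟨(LinearEquiv.ofBijective (A : V →ₗ[ℝ] W) ⟨hA,
    (LinearMap.injective_iff_surjective_of_finrank_eq_finrank h).1 hA⟩).toContinuousLinearEquiv,
    ContinuousLinearMap.ext fun _ => rfl⟩

lemma finrank_continuousDual [FiniteDimensional ℝ V] :
    Module.finrank ℝ (V →L[ℝ] ℝ) = Module.finrank ℝ V := by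
  rw [← (LinearMap.toContinuousLinearMap (𝕜 := ℝ) (E := V) (F' := ℝ)).finrank_eq]
  exact Subspace.dual_finrank_eq

lemma isInvertible_of_pos [FiniteDimensional ℝ V] (hg : ∀ v, v ≠ 0 → 0 < g v v) :
    g.IsInvertible := by
  refine isInvertible_of_injective finrank_continuousDual.symm ?_
  rw [injective_iff_map_eq_zero]
  intro v hv
  by_contra hne
  have := hg v hne
  rw [hv] at this
  exact lt_irrefl _ this

/-- If `f` is in the kernel, then `u = g⁻¹(f ∘ A)` satisfies `A u = 0`, hence `g(u, u) = f(A u) = 0`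
and `u = 0`. So `f ∘ A = 0`, and `f = 0` because `A` is onto. -/
lemma isInvertible_cometric [FiniteDimensional ℝ V] [FiniteDimensional ℝ W]
    (hg : ∀ v, v ≠ 0 → 0 < g v v) (hA : Function.Surjective A) :
    (A ∘L g.inverse ∘L (ContinuousLinearMap.compL ℝ V W ℝ).flip A).IsInvertible := by
  refine isInvertible_of_injective finrank_continuousDual ?_
  rw [injective_iff_map_eq_zero]
  intro f hf
  have h1 : g (g.inverse (f ∘L A)) = f ∘L A := (isInvertible_of_pos hg).self_apply_inverse _
  have h2 : A (g.inverse (f ∘L A)) = 0 := hf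
  have h3 : g.inverse (f ∘L A) = 0 := by
    by_contra hne
    have := hg _ hne
    rw [h1, ContinuousLinearMap.comp_apply, h2, map_zero] at this
    exact lt_irrefl _ this
  rw [h3, map_zero] at h1
  ext w
  obtain ⟨v, rfl⟩ := hA w
  exact congrArg (fun T : V →L[ℝ] ℝ => T v) h1.symm

/-- The lift is the vector that represents the functional `pushMetric g A w ∘ A` with respect to
`g`; it is horizontal because this functional kills `ker A`. Symmetry, positivity and naturality of
`pushMetric` all rest on it. -/
lemma exists_horizontal_lift [FiniteDimensional ℝ V] [FiniteDimensional ℝ W]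
    (hg : ∀ v, v ≠ 0 → 0 < g v v) (hA : Function.Surjective A) (w : W) :
    ∃ u, A u = w ∧ (∀ k, A k = 0 → g u k = 0) ∧ ∀ v, pushMetric g A w (A v) = g u v := by
  have hc := isInvertible_cometric hg hA
  have h1 : g (g.inverse (pushMetric g A w ∘L A)) = pushMetric g A w ∘L A :=
    (isInvertible_of_pos hg).self_apply_inverse _
  refine ⟨g.inverse (pushMetric g A w ∘L A), hc.self_apply_inverse _, fun k hk => ?_, fun v => ?_⟩
  · rw [h1, ContinuousLinearMap.comp_apply, hk, map_zero]
  · rw [h1, ContinuousLinearMap.comp_apply]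

/-- The defining property of `pushMetric`: it is isometric on horizontal vectors. -/
lemma pushMetric_apply [FiniteDimensional ℝ V] [FiniteDimensional ℝ W]
    (hg : ∀ v, v ≠ 0 → 0 < g v v) (hA : Function.Surjective A) {u : V}
    (hu : ∀ k, A k = 0 → g u k = 0) (v : V) : pushMetric g A (A u) (A v) = g u v := by
  obtain ⟨u', hu', hk, h⟩ := exists_horizontal_lift hg hA (A u)
  rw [h]
  -- Two horizontal lifts of one vector differ by a vector that is both vertical and horizontal,
  -- hence orthogonal to itself.
  have h0 : A (u - u') = 0 := by rw [map_sub, hu', sub_self]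
  have h1 : u - u' = 0 := by
    by_contra hne
    have := hg _ hne
    rw [map_sub g, sub_apply, hu _ h0, hk _ h0, sub_zero] at this
    exact lt_irrefl _ this
  rw [sub_eq_zero.1 h1]

lemma pushMetric_symm [FiniteDimensional ℝ V] [FiniteDimensional ℝ W]
    (hg : ∀ v, v ≠ 0 → 0 < g v v) (hs : ∀ u v, g u v = g v u) (hA : Function.Surjective A)
    (w w' : W) : pushMetric g A w w' = pushMetric g A w' w := by
  obtain ⟨u, rfl, -, h⟩ := exists_horizontal_lift hg hA w
  obtain ⟨u', rfl, -, h'⟩ := exists_horizontal_lift hg hA w'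
  rw [h, h', hs]

lemma pushMetric_pos [FiniteDimensional ℝ V] [FiniteDimensional ℝ W]
    (hg : ∀ v, v ≠ 0 → 0 < g v v) (hA : Function.Surjective A) (w : W) (hw : w ≠ 0) :
    0 < pushMetric g A w w := by
  obtain ⟨u, rfl, -, h⟩ := exists_horizontal_lift hg hA w
  rw [h]
  refine hg _ fun h0 => hw ?_
  rw [h0, map_zero]

/-- Naturality of `pushMetric`. -/
lemma pushMetric_map [FiniteDimensional ℝ V] [FiniteDimensional ℝ W] [FiniteDimensional ℝ V']
    [FiniteDimensional ℝ W'] {g' : V' →L[ℝ] V' →L[ℝ] ℝ} {A' : V' →L[ℝ] W'}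
    (hg : ∀ v, v ≠ 0 → 0 < g v v) (hA : Function.Surjective A)
    (hg' : ∀ v, v ≠ 0 → 0 < g' v v) (hA' : Function.Surjective A')
    {T : V →L[ℝ] V'} (hT : Function.Surjective T) {L : W →L[ℝ] W'} (hL : Function.Injective L)
    (hgT : ∀ u v, g' (T u) (T v) = g u v) (hAT : ∀ u, A' (T u) = L (A u)) (w w' : W) :
    pushMetric g' A' (L w) (L w') = pushMetric g A w w' := by
  obtain ⟨u, rfl, hu, h⟩ := exists_horizontal_lift hg hA w
  obtain ⟨u', rfl⟩ := hA w'
  rw [h, ← hAT, ← hAT, pushMetric_apply hg' hA', hgT]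
  -- The vector `T u` is horizontal for `A'`: a vertical vector of `V'` is `T k`, and injectivity of
  -- `L` makes `k` vertical for `A`.
  intro k hk
  obtain ⟨k, rfl⟩ := hT k
  rw [hgT]
  refine hu k (hL ?_)
  rw [← hAT, hk, map_zero]

/-- The formula is built from compositions and two inversions, and inversion is smooth at invertible
operators. No smooth choice of horizontal lifts is required. -/
lemma contDiffAt_pushMetric [FiniteDimensional ℝ V] [FiniteDimensional ℝ W]
    (hg : ∀ v, v ≠ 0 → 0 < g v v) (hA : Function.Surjective A) :
    ContDiffAt ℝ ∞ (fun z : (V →L[ℝ] V →L[ℝ] ℝ) × (V →L[ℝ] W) => pushMetric z.1 z.2) (g, A) := by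
  refine ContDiffAt.comp (g := ContinuousLinearMap.inverse) _
    (isInvertible_cometric hg hA).contDiffAt_map_inverse ?_
  refine contDiffAt_snd.clm_comp (ContDiffAt.clm_comp ?_ ?_)
  · exact ContDiffAt.comp (g := ContinuousLinearMap.inverse) _
      (isInvertible_of_pos hg).contDiffAt_map_inverse contDiffAt_fst
  · have h : ContDiff ℝ ∞ fun A : V →L[ℝ] W => (ContinuousLinearMap.compL ℝ V W ℝ).flip A :=
      ContinuousLinearMap.contDiff (𝕜 := ℝ) (E := V →L[ℝ] W)
        (F := (W →L[ℝ] ℝ) →L[ℝ] (V →L[ℝ] ℝ)) (ContinuousLinearMap.compL ℝ V W ℝ).flip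
    exact h.contDiffAt.comp _ contDiffAt_snd

/-- Compactness of the unit sphere gives `c > 0` with `c ‖v‖² ≤ g v v`. -/
lemma isVonNBounded_of_pos [FiniteDimensional ℝ V] (hg : ∀ v, v ≠ 0 → 0 < g v v) :
    Bornology.IsVonNBounded ℝ {v : V | g v v < 1} := by
  rw [NormedSpace.isVonNBounded_iff]
  obtain ⟨c, hc, hcg⟩ : ∃ c > 0, ∀ v ∈ Metric.sphere (0 : V) 1, c ≤ g v v := by
    rcases (Metric.sphere (0 : V) 1).eq_empty_or_nonempty with h | h
    · exact ⟨1, one_pos, by simp [h]⟩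
    · have hcont : ContinuousOn (fun v => g v v) (Metric.sphere (0 : V) 1) :=
        (g.continuous.clm_apply continuous_id).continuousOn
      obtain ⟨v, hv, hmin⟩ := (isCompact_sphere (0 : V) 1).exists_isMinOn h hcont
      exact ⟨g v v, hg v (ne_zero_of_mem_unit_sphere ⟨v, hv⟩), fun w hw => hmin hw⟩
  -- The bound follows from `‖v‖² ≤ c⁻¹` and `2 ‖v‖ ≤ 1 + ‖v‖²`, which avoids a square root.
  refine isBounded_iff_forall_norm_le.2 ⟨1 + c⁻¹, fun v hv => ?_⟩
  by_cases h0 : v = 0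
  · rw [h0, norm_zero]
    positivity
  have hn : 0 < ‖v‖ := norm_pos_iff.2 h0
  have h1 := hcg (‖v‖⁻¹ • v) (by simp [norm_smul, hn.ne'])
  rw [map_smul, map_smul, smul_apply, smul_eq_mul, smul_eq_mul] at h1
  have h2 : c * ‖v‖ ^ 2 ≤ g v v := by
    have := mul_le_mul_of_nonneg_right h1 (sq_nonneg ‖v‖)
    calc c * ‖v‖ ^ 2 ≤ ‖v‖⁻¹ * (‖v‖⁻¹ * g v v) * ‖v‖ ^ 2 := this
      _ = g v v := by field_simp
  have h3 : ‖v‖ ^ 2 ≤ c⁻¹ := by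
    rw [← one_div, le_div_iff₀ hc, mul_comm]
    exact h2.trans (le_of_lt hv)
  nlinarith [sq_nonneg (‖v‖ - 1)]

end PushMetric

/-! ### Fields of bilinear forms in trivializations -/

section BilinearForms

variable {E : Type*} [NormedAddCommGroup E] [NormedSpace ℝ E]
  {M : Type*} [TopologicalSpace M] [ChartedSpace E M] [IsManifold 𝓘(ℝ, E) ∞ M]

/-- The inverse at `x` of the trivialization of the tangent bundle at `x₀`. -/
def tangentSymmL (E : Type*) [NormedAddCommGroup E] [NormedSpace ℝ E]
    {M : Type*} [TopologicalSpace M] [ChartedSpace E M] [IsManifold 𝓘(ℝ, E) ∞ M]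
    (x₀ x : M) : E →L[ℝ] E :=
  (trivializationAt E (TangentSpace 𝓘(ℝ, E)) x₀).symmL ℝ x

/-- The trivialization of the tangent bundle at `x₀`, on the fibre over `x`. -/
def tangentMapAt (E : Type*) [NormedAddCommGroup E] [NormedSpace ℝ E]
    {M : Type*} [TopologicalSpace M] [ChartedSpace E M] [IsManifold 𝓘(ℝ, E) ∞ M]
    (x₀ x : M) : E →L[ℝ] E :=
  (trivializationAt E (TangentSpace 𝓘(ℝ, E)) x₀).continuousLinearMapAt ℝ x

omit [NormedSpace ℝ E] [IsManifold 𝓘(ℝ, E) ∞ M] in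
lemma chart_source_mem_nhds (x₀ : M) : (chartAt E x₀).source ∈ 𝓝 x₀ :=
  (chartAt E x₀).open_source.mem_nhds (mem_chart_source E x₀)

lemma tangentSymmL_tangentMapAt {x₀ x : M} (hx : x ∈ (chartAt E x₀).source) (v : E) :
    tangentSymmL E x₀ x (tangentMapAt E x₀ x v) = v :=
  (trivializationAt E (TangentSpace 𝓘(ℝ, E)) x₀).symmL_continuousLinearMapAt
    (by simpa using hx) v

lemma tangentMapAt_tangentSymmL {x₀ x : M} (hx : x ∈ (chartAt E x₀).source) (v : E) :
    tangentMapAt E x₀ x (tangentSymmL E x₀ x v) = v :=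
  (trivializationAt E (TangentSpace 𝓘(ℝ, E)) x₀).continuousLinearMapAt_symmL
    (by simpa using hx) v

lemma tangentSymmL_injective {x₀ x : M} (hx : x ∈ (chartAt E x₀).source) :
    Function.Injective (tangentSymmL E x₀ x) :=
  Function.LeftInverse.injective (g := tangentMapAt E x₀ x) (tangentMapAt_tangentSymmL hx)

lemma tangentSymmL_ne_zero {x₀ x : M} (hx : x ∈ (chartAt E x₀).source) {v : E} (hv : v ≠ 0) :
    tangentSymmL E x₀ x v ≠ 0 := fun h =>
  hv (tangentSymmL_injective hx (h.trans (map_zero (tangentSymmL E x₀ x)).symm))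

lemma tangentSymmL_surjective {x₀ x : M} (hx : x ∈ (chartAt E x₀).source) :
    Function.Surjective (tangentSymmL E x₀ x) :=
  fun v => ⟨tangentMapAt E x₀ x v, tangentSymmL_tangentMapAt hx v⟩

lemma tangentMapAt_surjective {x₀ x : M} (hx : x ∈ (chartAt E x₀).source) :
    Function.Surjective (tangentMapAt E x₀ x) :=
  fun v => ⟨tangentSymmL E x₀ x v, tangentMapAt_tangentSymmL hx v⟩

/-- A field of bilinear forms, in the trivialization of the tangent bundle at `x₀`. -/
def bilinInCoordinates (B : M → E →L[ℝ] E →L[ℝ] ℝ) (x₀ x : M) : E →L[ℝ] E →L[ℝ] ℝ :=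
  (B x).bilinearComp (tangentSymmL E x₀ x) (tangentSymmL E x₀ x)

/-- This replaces smoothness of a section of a bundle by smoothness of a map to a fixed vector
space. The two coordinate expressions agree near `x₀` because the trivial line bundle is trivialized
by the identity. -/
lemma contMDiffAt_bilin_iff
    (B : ∀ x : M, TangentSpace 𝓘(ℝ, E) x →L[ℝ] TangentSpace 𝓘(ℝ, E) x →L[ℝ] ℝ) (x₀ : M) :
    ContMDiffAt 𝓘(ℝ, E) (𝓘(ℝ, E).prod 𝓘(ℝ, E →L[ℝ] E →L[ℝ] ℝ)) ∞
      (fun x : M => Bundle.TotalSpace.mk' (E →L[ℝ] E →L[ℝ] ℝ) x (B x)) x₀ ↔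
    ContMDiffAt 𝓘(ℝ, E) 𝓘(ℝ, E →L[ℝ] E →L[ℝ] ℝ) ∞ (bilinInCoordinates (fun x => B x) x₀) x₀ := by
  rw [contMDiffAt_hom_bundle]
  have key : ∀ᶠ x in 𝓝 x₀, ContinuousLinearMap.inCoordinates E (TangentSpace 𝓘(ℝ, E))
      (E →L[ℝ] ℝ) (fun x : M => TangentSpace 𝓘(ℝ, E) x →L[ℝ] ℝ) x₀ x x₀ x (B x) =
      bilinInCoordinates (fun x => B x) x₀ x := by
    filter_upwards [chart_source_mem_nhds (E := E) x₀] with x hx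
    have hx' : x ∈ (trivializationAt E (TangentSpace 𝓘(ℝ, E)) x₀).baseSet := by simpa using hx
    ext a b
    refine (inCoordinates_apply_eq₂ (F₃ := ℝ) (E₃ := Bundle.Trivial M ℝ) hx' hx'
      (Set.mem_univ x)).trans ?_
    have htriv (c : ℝ) : (trivializationAt ℝ (Bundle.Trivial M ℝ) x₀).linearMapAt ℝ x c = c :=
      DFunLike.congr_fun (Bundle.Trivial.linearMapAt_trivialization ℝ M ℝ x) c
    have hsymm (v : E) : tangentSymmL E x₀ x v =
        (trivializationAt E (TangentSpace 𝓘(ℝ, E)) x₀).symm x v :=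
      Bundle.Trivialization.symmL_apply _ hx' v
    have hB : bilinInCoordinates (fun x => B x) x₀ x a b =
        (B x : E →L[ℝ] E →L[ℝ] ℝ) (tangentSymmL E x₀ x a) (tangentSymmL E x₀ x b) := rfl
    refine (htriv _).trans ?_
    rw [hB, hsymm, hsymm]
  constructor
  · exact fun h => h.2.congr_of_eventuallyEq (key.mono fun x hx => hx.symm)
  · exact fun h => ⟨contMDiffAt_id, h.congr_of_eventuallyEq key⟩

end BilinearForms

/-! ### Differentials of immersions and submersions -/

section Differentials

variable {E₁ : Type*} [NormedAddCommGroup E₁] [NormedSpace ℝ E₁]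
  {N : Type*} [TopologicalSpace N] [ChartedSpace E₁ N] [IsManifold 𝓘(ℝ, E₁) ∞ N]
  {E₂ : Type*} [NormedAddCommGroup E₂] [NormedSpace ℝ E₂]
  {B : Type*} [TopologicalSpace B] [ChartedSpace E₂ B] [IsManifold 𝓘(ℝ, E₂) ∞ B]

/-- The differential of `f` at `x`, as a map of the model spaces. -/
def modelDeriv (E₁ E₂ : Type*) [NormedAddCommGroup E₁] [NormedSpace ℝ E₁]
    [NormedAddCommGroup E₂] [NormedSpace ℝ E₂]
    {N : Type*} [TopologicalSpace N] [ChartedSpace E₁ N]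
    {B : Type*} [TopologicalSpace B] [ChartedSpace E₂ B]
    (f : N → B) (x : N) : E₁ →L[ℝ] E₂ :=
  mfderiv 𝓘(ℝ, E₁) 𝓘(ℝ, E₂) f x

/-- The differential of `f` at `x`, in the trivializations of the tangent bundles at `x₀` and
`f x₀`. -/
def derivInCoordinates (E₁ E₂ : Type*) [NormedAddCommGroup E₁] [NormedSpace ℝ E₁]
    [NormedAddCommGroup E₂] [NormedSpace ℝ E₂]
    {N : Type*} [TopologicalSpace N] [ChartedSpace E₁ N] [IsManifold 𝓘(ℝ, E₁) ∞ N]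
    {B : Type*} [TopologicalSpace B] [ChartedSpace E₂ B] [IsManifold 𝓘(ℝ, E₂) ∞ B]
    (f : N → B) (x₀ x : N) : E₁ →L[ℝ] E₂ :=
  tangentMapAt E₂ (f x₀) (f x) ∘L modelDeriv E₁ E₂ f x ∘L tangentSymmL E₁ x₀ x

lemma contMDiffAt_derivInCoordinates {f : N → B} {x₀ : N}
    (hf : ContMDiffAt 𝓘(ℝ, E₁) 𝓘(ℝ, E₂) ∞ f x₀) :
    ContMDiffAt 𝓘(ℝ, E₁) 𝓘(ℝ, E₁ →L[ℝ] E₂) ∞ (derivInCoordinates E₁ E₂ f x₀) x₀ :=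
  hf.mfderiv_const (m := ∞) (by simp)

-- The base point `y` is kept free so that the lemma applies when `f x = y` is only a proved
-- equality, as for a section with `s (f x) = x`.
omit [IsManifold 𝓘(ℝ, E₁) ∞ N] [IsManifold 𝓘(ℝ, E₂) ∞ B] in
lemma modelDeriv_comp {E₃ : Type*} [NormedAddCommGroup E₃] [NormedSpace ℝ E₃]
    {C : Type*} [TopologicalSpace C] [ChartedSpace E₃ C] {g : B → C} {f : N → B} {x : N} {y : B}
    (hy : f x = y) (hg : MDifferentiableAt 𝓘(ℝ, E₂) 𝓘(ℝ, E₃) g y)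
    (hf : MDifferentiableAt 𝓘(ℝ, E₁) 𝓘(ℝ, E₂) f x) :
    modelDeriv E₁ E₃ (g ∘ f) x = modelDeriv E₂ E₃ g y ∘L modelDeriv E₁ E₂ f x := by
  subst hy
  exact mfderiv_comp x hg hf

omit [IsManifold 𝓘(ℝ, E₁) ∞ N] in
lemma modelDeriv_eq_id {f : N → N} {x : N} (hf : f =ᶠ[𝓝 x] id) :
    modelDeriv E₁ E₁ f x = ContinuousLinearMap.id ℝ E₁ :=
  (hf.mfderiv_eq).trans mfderiv_id

omit [IsManifold 𝓘(ℝ, E₁) ∞ N] [IsManifold 𝓘(ℝ, E₂) ∞ B] in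
/-- An immersion has a smooth left inverse near each point. -/
lemma exists_local_retraction {f : N → B} {x : N}
    (hf : Manifold.IsImmersionAt 𝓘(ℝ, E₁) 𝓘(ℝ, E₂) ∞ f x) :
    ∃ r : B → N, ContMDiffAt 𝓘(ℝ, E₂) 𝓘(ℝ, E₁) ∞ r (f x) ∧ r ∘ f =ᶠ[𝓝 x] id := by
  have hw := hf.writtenInCharts
  simp only [mfld_simps] at hw
  have hcoord : ∀ z ∈ hf.domChart.source, hf.codChart (f z) = hf.equiv (hf.domChart z, 0) := by
    intro z hz
    have := hw (hf.domChart.map_source hz)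
    simpa [hf.domChart.left_inv hz] using this
  -- In suitable charts the immersion is `z ↦ (z, 0)`; the retraction drops the second component.
  refine ⟨fun y => hf.domChart.symm (hf.equiv.symm (hf.codChart y)).1, ?_, ?_⟩
  · have hx := hcoord x hf.mem_domChart_source
    have h1 : ContMDiffAt 𝓘(ℝ, E₂) 𝓘(ℝ, E₂) ∞ hf.codChart (f x) :=
      contMDiffAt_of_mem_maximalAtlas hf.codChart_mem_maximalAtlas hf.mem_codChart_source
    have h2 : ContMDiffAt 𝓘(ℝ, E₁) 𝓘(ℝ, E₁) ∞ hf.domChart.symm (hf.domChart x) :=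
      contMDiffAt_symm_of_mem_maximalAtlas hf.domChart_mem_maximalAtlas
        (hf.domChart.map_source hf.mem_domChart_source)
    have h3 : ContMDiff 𝓘(ℝ, E₂) 𝓘(ℝ, E₁) ∞ fun y => (hf.equiv.symm y).1 :=
      (contDiff_fst.comp hf.equiv.symm.contDiff).contMDiff
    refine ContMDiffAt.comp (f x) (g := hf.domChart.symm)
      (f := fun y => (hf.equiv.symm (hf.codChart y)).1) ?_ (h3.contMDiffAt.comp (f x) h1)
    rw [hx]
    simpa using h2
  · filter_upwards [hf.domChart.open_source.mem_nhds hf.mem_domChart_source] with z hz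
    simp [hcoord z hz, hf.domChart.left_inv hz]

omit [IsManifold 𝓘(ℝ, E₁) ∞ N] [IsManifold 𝓘(ℝ, E₂) ∞ B] in
/-- A submersion has a smooth section through each point. -/
lemma exists_local_section {f : N → B} {x : N}
    (hf : Manifold.IsSubmersionAt 𝓘(ℝ, E₁) 𝓘(ℝ, E₂) ∞ f x) :
    ∃ s : B → N, ContMDiffAt 𝓘(ℝ, E₂) 𝓘(ℝ, E₁) ∞ s (f x) ∧ s (f x) = x ∧
      f ∘ s =ᶠ[𝓝 (f x)] id := by
  have hw := hf.writtenInCharts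
  simp only [mfld_simps] at hw
  have hx : hf.codChart (f x) = (hf.equiv (hf.domChart x)).1 := by
    have := hw (hf.domChart.map_source hf.mem_domChart_source)
    simpa [hf.domChart.left_inv hf.mem_domChart_source] using this
  -- In suitable charts the submersion is a projection; the section keeps the complementary
  -- coordinate equal to that of `x`.
  let j : B → E₁ := fun y => hf.equiv.symm (hf.codChart y, (hf.equiv (hf.domChart x)).2)
  have hjx : j (f x) = hf.domChart x := by
    simp [j, hx]
  have h1 : ContMDiffAt 𝓘(ℝ, E₂) 𝓘(ℝ, E₂) ∞ hf.codChart (f x) :=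
    contMDiffAt_of_mem_maximalAtlas hf.codChart_mem_maximalAtlas hf.mem_codChart_source
  have h2 : ContMDiffAt 𝓘(ℝ, E₁) 𝓘(ℝ, E₁) ∞ hf.domChart.symm (hf.domChart x) :=
    contMDiffAt_symm_of_mem_maximalAtlas hf.domChart_mem_maximalAtlas
      (hf.domChart.map_source hf.mem_domChart_source)
  have h3 : ContMDiff 𝓘(ℝ, E₂) 𝓘(ℝ, E₁) ∞
      fun y => hf.equiv.symm (y, (hf.equiv (hf.domChart x)).2) :=
    (hf.equiv.symm.contDiff.comp (contDiff_id.prodMk contDiff_const)).contMDiff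
  have hj : ContMDiffAt 𝓘(ℝ, E₂) 𝓘(ℝ, E₁) ∞ j (f x) := h3.contMDiffAt.comp (f x) h1
  refine ⟨fun y => hf.domChart.symm (j y), ?_, ?_, ?_⟩
  · exact ContMDiffAt.comp (f x) (g := hf.domChart.symm) (f := j) (by rw [hjx]; exact h2) hj
  · simp [hjx, hf.domChart.left_inv hf.mem_domChart_source]
  · have hmem : j ⁻¹' hf.domChart.target ∈ 𝓝 (f x) := by
      refine hj.continuousAt.preimage_mem_nhds (hf.domChart.open_target.mem_nhds ?_)
      rw [hjx]
      exact hf.domChart.map_source hf.mem_domChart_source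
    filter_upwards [hmem, hf.codChart.open_source.mem_nhds hf.mem_codChart_source] with y hy hy'
    refine hf.codChart.injOn
      (hf.source_subset_preimage_source (hf.domChart.map_target hy)) hy' ?_
    have := hw hy
    simpa [j] using this

omit [IsManifold 𝓘(ℝ, E₁) ∞ N] [IsManifold 𝓘(ℝ, E₂) ∞ B] in
lemma injective_modelDeriv {f : N → B} {x : N}
    (hf : Manifold.IsImmersionAt 𝓘(ℝ, E₁) 𝓘(ℝ, E₂) ∞ f x) :
    Function.Injective (modelDeriv E₁ E₂ f x) := by
  obtain ⟨r, hr, hrf⟩ := exists_local_retraction hf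
  have h := modelDeriv_comp (x := x) rfl (hr.mdifferentiableAt (by simp))
    (hf.contMDiffAt.mdifferentiableAt (by simp))
  rw [modelDeriv_eq_id hrf] at h
  exact Function.LeftInverse.injective (g := modelDeriv E₂ E₁ r (f x))
    fun v => (DFunLike.congr_fun h v).symm

omit [IsManifold 𝓘(ℝ, E₁) ∞ N] [IsManifold 𝓘(ℝ, E₂) ∞ B] in
lemma surjective_modelDeriv {f : N → B} {x : N}
    (hf : Manifold.IsSubmersionAt 𝓘(ℝ, E₁) 𝓘(ℝ, E₂) ∞ f x) :
    Function.Surjective (modelDeriv E₁ E₂ f x) := by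
  obtain ⟨s, hs, hsx, hfs⟩ := exists_local_section hf
  have h := modelDeriv_comp (x := f x) hsx (hf.contMDiffAt.mdifferentiableAt (by simp))
    (hs.mdifferentiableAt (by simp))
  rw [modelDeriv_eq_id hfs] at h
  exact fun v => ⟨modelDeriv E₂ E₁ s (f x) v, (DFunLike.congr_fun h v).symm⟩

end Differentials

/-! ### Pullback metrics and Riemannian submersions -/

section Metrics

variable {E₁ : Type*} [NormedAddCommGroup E₁] [NormedSpace ℝ E₁] [FiniteDimensional ℝ E₁]
  {N : Type*} [TopologicalSpace N] [ChartedSpace E₁ N] [IsManifold 𝓘(ℝ, E₁) ∞ N]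
  {E₂ : Type*} [NormedAddCommGroup E₂] [NormedSpace ℝ E₂] [FiniteDimensional ℝ E₂]
  {B : Type*} [TopologicalSpace B] [ChartedSpace E₂ B] [IsManifold 𝓘(ℝ, E₂) ∞ B]

/-- A smooth field of inner products on the model space defines a Riemannian metric. -/
def RiemannianMetricOn.mkOfModel (b : N → E₁ →L[ℝ] E₁ →L[ℝ] ℝ)
    (hs : ∀ x v w, b x v w = b x w v) (hpos : ∀ x v, v ≠ 0 → 0 < b x v v)
    (hb : ∀ x₀, ContMDiffAt 𝓘(ℝ, E₁) 𝓘(ℝ, E₁ →L[ℝ] E₁ →L[ℝ] ℝ) ∞ (bilinInCoordinates b x₀) x₀) :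
    RiemannianMetricOn E₁ N where
  inner x := b x
  symm := hs
  pos := hpos
  isVonNBounded x := isVonNBounded_of_pos (V := E₁) (g := b x) (hpos x)
  contMDiff x₀ := (contMDiffAt_bilin_iff (fun x => b x) x₀).2 (hb x₀)

/-- The Riemannian metric `g`, on the model space. -/
def RiemannianMetricOn.toModel (g : RiemannianMetricOn E₁ N) (x : N) : E₁ →L[ℝ] E₁ →L[ℝ] ℝ :=
  g.inner x

omit [FiniteDimensional ℝ E₁] in
lemma RiemannianMetricOn.toModel_pos (g : RiemannianMetricOn E₁ N) (x : N) (v : E₁) (hv : v ≠ 0) :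
    0 < g.toModel x v v := g.pos x v hv

omit [FiniteDimensional ℝ E₁] in
lemma RiemannianMetricOn.toModel_symm (g : RiemannianMetricOn E₁ N) (x : N) (v w : E₁) :
    g.toModel x v w = g.toModel x w v := g.symm x v w

omit [FiniteDimensional ℝ E₁] in
lemma RiemannianMetricOn.contMDiffAt_toModel (g : RiemannianMetricOn E₁ N) (x₀ : N) :
    ContMDiffAt 𝓘(ℝ, E₁) 𝓘(ℝ, E₁ →L[ℝ] E₁ →L[ℝ] ℝ) ∞ (bilinInCoordinates g.toModel x₀) x₀ :=
  (contMDiffAt_bilin_iff g.inner x₀).1 (g.contMDiff x₀)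

lemma contDiff_bilinearComp {V W : Type*} [NormedAddCommGroup V] [NormedSpace ℝ V]
    [NormedAddCommGroup W] [NormedSpace ℝ W] :
    ContDiff ℝ ∞ fun z : (W →L[ℝ] W →L[ℝ] ℝ) × (V →L[ℝ] W) => z.1.bilinearComp z.2 z.2 := by
  have h : ContDiff ℝ ∞ fun z : (W →L[ℝ] W →L[ℝ] ℝ) × (V →L[ℝ] W) =>
      (ContinuousLinearMap.compL ℝ V W ℝ).flip z.2 ∘L z.1 ∘L z.2 :=
    ((ContinuousLinearMap.contDiff _).comp contDiff_snd).clm_comp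
      (contDiff_fst.clm_comp contDiff_snd)
  exact h

omit [FiniteDimensional ℝ E₁] [FiniteDimensional ℝ E₂] in
lemma modelDeriv_tangentSymmL {f : N → B} {x₀ x : N} (hfx : f x ∈ (chartAt E₂ (f x₀)).source)
    (u : E₁) : modelDeriv E₁ E₂ f x (tangentSymmL E₁ x₀ x u) =
      tangentSymmL E₂ (f x₀) (f x) (derivInCoordinates E₁ E₂ f x₀ x u) :=
  (tangentSymmL_tangentMapAt hfx _).symm

omit [FiniteDimensional ℝ E₁] [FiniteDimensional ℝ E₂] in
lemma surjective_derivInCoordinates {f : N → B} {x₀ x : N} (hx : x ∈ (chartAt E₁ x₀).source)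
    (hfx : f x ∈ (chartAt E₂ (f x₀)).source) (hf : Function.Surjective (modelDeriv E₁ E₂ f x)) :
    Function.Surjective (derivInCoordinates E₁ E₂ f x₀ x) :=
  (tangentMapAt_surjective hfx).comp (hf.comp (tangentSymmL_surjective hx))

omit [FiniteDimensional ℝ E₁] in
lemma RiemannianMetricOn.bilinInCoordinates_pos (g : RiemannianMetricOn E₁ N) {x₀ x : N}
    (hx : x ∈ (chartAt E₁ x₀).source) (v : E₁) (hv : v ≠ 0) :
    0 < bilinInCoordinates g.toModel x₀ x v v :=
  g.toModel_pos x (tangentSymmL E₁ x₀ x v) (tangentSymmL_ne_zero hx hv)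

omit [FiniteDimensional ℝ E₂] in
/-- The pullback of a Riemannian metric by an immersion. -/
lemma exists_isPullbackMetric {f : N → B} (hf : Manifold.IsImmersion 𝓘(ℝ, E₁) 𝓘(ℝ, E₂) ∞ f)
    (g : RiemannianMetricOn E₂ B) : ∃ h : RiemannianMetricOn E₁ N, IsPullbackMetric h g f := by
  refine ⟨RiemannianMetricOn.mkOfModel
    (fun x => (g.toModel (f x)).bilinearComp (modelDeriv E₁ E₂ f x) (modelDeriv E₁ E₂ f x))
    (fun x v w => g.toModel_symm _ _ _) (fun x v hv => g.toModel_pos _ _ ?_) (fun x₀ => ?_),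
    fun x u v => rfl⟩
  · exact (map_ne_zero_iff _ (injective_modelDeriv (hf.isImmersionAt x))).2 hv
  · have hfx := (hf.isImmersionAt x₀).contMDiffAt
    refine (contDiff_bilinearComp.contMDiff.contMDiffAt.comp x₀
      (((g.contMDiffAt_toModel (f x₀)).comp x₀ hfx).prodMk_space
        (contMDiffAt_derivInCoordinates hfx))).congr_of_eventuallyEq ?_
    filter_upwards [hfx.continuousAt.preimage_mem_nhds (chart_source_mem_nhds (E := E₂) (f x₀))]
      with x hx
    ext u v
    change g.toModel (f x) (modelDeriv E₁ E₂ f x (tangentSymmL E₁ x₀ x u))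
      (modelDeriv E₁ E₂ f x (tangentSymmL E₁ x₀ x v)) = _
    rw [modelDeriv_tangentSymmL hx, modelDeriv_tangentSymmL hx]
    rfl

/-- A Riemannian metric on the total space of a surjective submersion descends to the base when
it is the same, transversally to the fibre, at any two points of a fibre. -/
lemma exists_isRiemannianSubmersion {f : N → B}
    (hf : Manifold.IsSubmersion 𝓘(ℝ, E₁) 𝓘(ℝ, E₂) ∞ f) (hsurj : Function.Surjective f)
    (g : RiemannianMetricOn E₁ N)
    (hinv : ∀ m m', f m = f m' → ∃ T : E₁ →L[ℝ] E₁, Function.Surjective T ∧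
      (∀ u v, g.toModel m' (T u) (T v) = g.toModel m u v) ∧
      ∀ u, modelDeriv E₁ E₂ f m' (T u) = modelDeriv E₁ E₂ f m u) :
    ∃ h : RiemannianMetricOn E₂ B, IsRiemannianSubmersion g h f := by
  have hA (m : N) : Function.Surjective (modelDeriv E₁ E₂ f m) :=
    surjective_modelDeriv (hf.isSubmersionAt m)
  -- This section is only set-theoretic. The metric does not depend on it by `hb`, where the
  -- operator `T` from `hinv` compares two points of a fibre.
  let σ := Function.surjInv hsurj
  let b : B → E₂ →L[ℝ] E₂ →L[ℝ] ℝ := fun q =>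
    pushMetric (g.toModel (σ q)) (modelDeriv E₁ E₂ f (σ q))
  have hb (m : N) : b (f m) = pushMetric (g.toModel m) (modelDeriv E₁ E₂ f m) := by
    obtain ⟨T, hT, hgT, hAT⟩ := hinv (σ (f m)) m (Function.surjInv_eq hsurj _)
    ext w w'
    exact (pushMetric_map (L := ContinuousLinearMap.id ℝ E₂) (g.toModel_pos _) (hA _)
      (g.toModel_pos _) (hA m) hT Function.injective_id hgT hAT w w').symm
  -- Passing to trivializations is another instance of the naturality of `pushMetric`.
  have hcoord (m₀ m : N) (hm : m ∈ (chartAt E₁ m₀).source)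
      (hfm : f m ∈ (chartAt E₂ (f m₀)).source) :
      bilinInCoordinates b (f m₀) (f m) =
        pushMetric (bilinInCoordinates g.toModel m₀ m) (derivInCoordinates E₁ E₂ f m₀ m) := by
    ext w w'
    change b (f m) (tangentSymmL E₂ (f m₀) (f m) w) (tangentSymmL E₂ (f m₀) (f m) w') = _
    rw [hb]
    exact pushMetric_map (T := tangentSymmL E₁ m₀ m) (g.bilinInCoordinates_pos hm)
      (surjective_derivInCoordinates hm hfm (hA m)) (g.toModel_pos m) (hA m)
      (tangentSymmL_surjective hm) (tangentSymmL_injective hfm) (fun _ _ => rfl)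
      (modelDeriv_tangentSymmL hfm) w w'
  refine ⟨RiemannianMetricOn.mkOfModel b
    (fun q => pushMetric_symm (g.toModel_pos _) (g.toModel_symm _) (hA _))
    (fun q => pushMetric_pos (g.toModel_pos _) (hA _)) (fun q₀ => ?_), hf.contMDiff, hA,
    fun m u v hu hv => ?_⟩
  · obtain ⟨m₀, rfl⟩ := hsurj q₀
    -- Near `f m₀` the metric may be computed at `s q` for a smooth local section `s`, where it is a
    -- smooth function of the coordinate expressions of `g` and `df`.
    obtain ⟨s, hs, hsm, hfs⟩ := exists_local_section (hf.isSubmersionAt m₀)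
    have hg : ContMDiffAt 𝓘(ℝ, E₂) 𝓘(ℝ, E₁ →L[ℝ] E₁ →L[ℝ] ℝ) ∞
        (fun q => bilinInCoordinates g.toModel m₀ (s q)) (f m₀) :=
      ContMDiffAt.comp (f m₀) (g := bilinInCoordinates g.toModel m₀)
        (by rw [hsm]; exact g.contMDiffAt_toModel m₀) hs
    have hd : ContMDiffAt 𝓘(ℝ, E₂) 𝓘(ℝ, E₁ →L[ℝ] E₂) ∞
        (fun q => derivInCoordinates E₁ E₂ f m₀ (s q)) (f m₀) :=
      ContMDiffAt.comp (f m₀) (g := derivInCoordinates E₁ E₂ f m₀)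
        (by rw [hsm]; exact contMDiffAt_derivInCoordinates (hf.contMDiff m₀)) hs
    refine (ContMDiffAt.comp (f m₀)
      (g := fun z : (E₁ →L[ℝ] E₁ →L[ℝ] ℝ) × (E₁ →L[ℝ] E₂) => pushMetric z.1 z.2)
      (ContDiffAt.contMDiffAt (contDiffAt_pushMetric ?_ ?_))
      (hg.prodMk_space hd)).congr_of_eventuallyEq ?_
    · simpa only [hsm] using g.bilinInCoordinates_pos (mem_chart_source E₁ m₀)
    · simpa only [hsm] using surjective_derivInCoordinates (mem_chart_source E₁ m₀)
        (mem_chart_source E₂ (f m₀)) (hA m₀)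
    · have hnhds : (chartAt E₁ m₀).source ∈ 𝓝 (s (f m₀)) := by
        rw [hsm]
        exact chart_source_mem_nhds m₀
      filter_upwards [hfs, hs.continuousAt.preimage_mem_nhds hnhds,
        chart_source_mem_nhds (E := E₂) (f m₀)] with q hq hq₁ hq₂
      have hq' : f (s q) = q := hq
      have := hcoord m₀ (s q) hq₁ (by rwa [hq'])
      rwa [hq'] at this
  · change g.toModel m u v = b (f m) (modelDeriv E₁ E₂ f m u) (modelDeriv E₁ E₂ f m v)
    rw [hb]
    exact (pushMetric_apply (g.toModel_pos m) (hA m) hu v).symm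

end Metrics

/-! ### The metric on the reduced space -/

section ReducedMetric

variable {E : Type*} [NormedAddCommGroup E] [NormedSpace ℝ E]
  {M : Type*} [TopologicalSpace M] [ChartedSpace E M] [IsManifold 𝓘(ℝ, E) ∞ M]
  {F : Type*} [NormedAddCommGroup F] [NormedSpace ℝ F]
  {G : Type*} [TopologicalSpace G] [ChartedSpace F G] [Group G] [LieGroup 𝓘(ℝ, F) ∞ G]
  [MulAction G M] [ContMDiffSMul 𝓘(ℝ, F) 𝓘(ℝ, E) ∞ G M]
  {Ω : SymplecticForm E M} {μ : M → LieDual F} {hμ : IsHamiltonianAction G Ω μ} {β : LieDual F}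

/-- A continuous map into the level set is smooth when its composite with the immersion into `M` is,
and that composite is the restriction of the action on `M`. -/
lemma contMDiff_smul_level (S : ReducedManifold hμ β) (a : coadjointIsotropy G β) :
    ContMDiff (𝓡 S.levelDim) (𝓡 S.levelDim) ∞ (fun x : levelSet hμ β => a • x) := by
  have hι := S.isSmoothEmbedding_incl
  have hcomp : ContMDiff (𝓡 S.levelDim) 𝓘(ℝ, E) ∞
      ((Subtype.val : levelSet hμ β → M) ∘ fun x : levelSet hμ β => a • x) :=
    (contMDiff_const_smul E F (a : G)).comp hι.isImmersion.contMDiff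
  exact (ContMDiff.iff_comp_isImmersion hι.isImmersion).2
    ⟨hι.isEmbedding.continuous_iff.2 hcomp.continuous, hcomp⟩

omit [ContMDiffSMul 𝓘(ℝ, F) 𝓘(ℝ, E) ∞ G M] in
lemma reducedProj_smul (a : coadjointIsotropy G β) (x : levelSet hμ β) :
    reducedProj hμ β (a • x) = reducedProj hμ β x :=
  Quotient.sound ⟨a, rfl⟩

lemma surjective_modelDeriv_smul_level (S : ReducedManifold hμ β) (a : coadjointIsotropy G β)
    (x : levelSet hμ β) :
    Function.Surjective (modelDeriv (EuclideanSpace ℝ (Fin S.levelDim))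
      (EuclideanSpace ℝ (Fin S.levelDim)) (fun y : levelSet hμ β => a • y) x) := by
  have h := modelDeriv_comp (x := a • x) (f := fun y : levelSet hμ β => a⁻¹ • y)
    (g := fun y : levelSet hμ β => a • y) (inv_smul_smul a x)
    ((contMDiff_smul_level S a).mdifferentiableAt (by simp))
    ((contMDiff_smul_level S a⁻¹).mdifferentiableAt (by simp))
  have hid : (fun y : levelSet hμ β => a • y) ∘ (fun y : levelSet hμ β => a⁻¹ • y) = id :=
    funext fun y => smul_inv_smul a y
  rw [hid, modelDeriv_eq_id (.refl _ _)] at h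
  exact fun v => ⟨_, (DFunLike.congr_fun h v).symm⟩

/-- Differentiate the equivariance `i(a • x) = a • i(x)` of the inclusion and use that `a` is an
isometry of `M`. -/
lemma pullbackMetric_smul_level (S : ReducedManifold hμ β) {gM : RiemannianMetricOn E M}
    (hG : ActsByIsometries G gM)
    {gL : RiemannianMetricOn (EuclideanSpace ℝ (Fin S.levelDim)) (levelSet hμ β)}
    (hL : IsPullbackMetric gL gM (Subtype.val : levelSet hμ β → M)) (a : coadjointIsotropy G β)
    (x : levelSet hμ β) (u v : EuclideanSpace ℝ (Fin S.levelDim)) :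
    gL.toModel (a • x) (modelDeriv _ _ (fun y : levelSet hμ β => a • y) x u)
      (modelDeriv _ _ (fun y : levelSet hμ β => a • y) x v) = gL.toModel x u v := by
  have hι : ∀ y, MDifferentiableAt (𝓡 S.levelDim) 𝓘(ℝ, E) (Subtype.val : levelSet hμ β → M) y :=
    fun y => S.isSmoothEmbedding_incl.isImmersion.contMDiff.mdifferentiableAt (by simp)
  have h1 := modelDeriv_comp (x := x) (g := (Subtype.val : levelSet hμ β → M))
    (f := fun y : levelSet hμ β => a • y) rfl (hι _)
    ((contMDiff_smul_level S a).mdifferentiableAt (by simp))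
  have h2 := modelDeriv_comp (x := x) (f := (Subtype.val : levelSet hμ β → M))
    (g := fun y : M => (a : G) • y) rfl
    ((contMDiff_const_smul E F (a : G)).mdifferentiableAt (by simp)) (hι x)
  have h3 (w) := DFunLike.congr_fun (h1.symm.trans h2) w
  have hL' (y : levelSet hμ β) (u v) : gL.toModel y u v = gM.toModel y
    (modelDeriv _ _ (Subtype.val : levelSet hμ β → M) y u)
    (modelDeriv _ _ (Subtype.val : levelSet hμ β → M) y v) := hL y u v
  have hG' (y : M) (u v) : gM.toModel ((a : G) • y) (modelDeriv _ _ (fun y : M => (a : G) • y) y u)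
    (modelDeriv _ _ (fun y : M => (a : G) • y) y v) = gM.toModel y u v := hG a y u v
  rw [hL', hL', ← hG' (x : M)]
  exact congrArg₂ (fun u v => gM.toModel ((a : G) • (x : M)) u v) (h3 u) (h3 v)

/-- Two points of a fibre differ by some `a` in `G_β`. Its differential is the required comparison
of tangent spaces: it is isometric, and it covers the identity because `π ∘ a = π`. -/
lemma exists_reducedMetric (S : ReducedManifold hμ β) {gM : RiemannianMetricOn E M}
    (hG : ActsByIsometries G gM)
    {gL : RiemannianMetricOn (EuclideanSpace ℝ (Fin S.levelDim)) (levelSet hμ β)}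
    (hL : IsPullbackMetric gL gM (Subtype.val : levelSet hμ β → M)) :
    ∃ gβ : RiemannianMetricOn (EuclideanSpace ℝ (Fin S.reducedDim)) (ReducedSpace hμ β),
      IsRiemannianSubmersion gL gβ (reducedProj hμ β) := by
  refine exists_isRiemannianSubmersion S.isSubmersion_proj Quotient.mk_surjective gL
    fun m m' hm => ?_
  obtain ⟨a, rfl⟩ : ∃ a : coadjointIsotropy G β, a • m = m' := Quotient.exact hm.symm
  refine ⟨modelDeriv _ _ (fun y : levelSet hμ β => a • y) m,
    surjective_modelDeriv_smul_level S a m, pullbackMetric_smul_level S hG hL a m, fun u => ?_⟩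
  have h := modelDeriv_comp (x := m) (g := reducedProj hμ β)
    (f := fun y : levelSet hμ β => a • y) rfl
    (S.isSubmersion_proj.contMDiff.mdifferentiableAt (by simp))
    ((contMDiff_smul_level S a).mdifferentiableAt (by simp))
  have hπ : reducedProj hμ β ∘ (fun y : levelSet hμ β => a • y) = reducedProj hμ β :=
    funext (reducedProj_smul a)
  rw [hπ] at h
  exact (DFunLike.congr_fun h u).symm

end ReducedMetric

end SymplecticReduction

end

theorem mainTheorem2
    {E : Type*} [NormedAddCommGroup E] [NormedSpace ℝ E] [FiniteDimensional ℝ E]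
    {M : Type*} [TopologicalSpace M] [T2Space M] [SecondCountableTopology M]
    [ChartedSpace E M] [IsManifold 𝓘(ℝ, E) ∞ M]
    {F : Type*} [NormedAddCommGroup F] [NormedSpace ℝ F] [FiniteDimensional ℝ F]
    {G : Type*} [TopologicalSpace G] [T2Space G] [SecondCountableTopology G]
    [ChartedSpace F G] [Group G] [LieGroup 𝓘(ℝ, F) ∞ G]
    [MulAction G M] [ContMDiffSMul 𝓘(ℝ, F) 𝓘(ℝ, E) ∞ G M]
    (Ω : SymplecticForm E M) (gM : RiemannianMetricOn E M) (hG : ActsByIsometries G gM)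
    (μ : M → LieDual F) (hμ : IsHamiltonianAction G Ω μ)
    (β : LieDual F) (hβ : IsRegularValue E μ β)
    (hfree : IsFreeOnLevel hμ β)
    (hproper : ProperSMul (coadjointIsotropy G β) (levelSet hμ β)) :
    Nonempty (ReducedManifold hμ β) ∧
    ∀ S : ReducedManifold hμ β,
      ∃ gL : RiemannianMetricOn (EuclideanSpace ℝ (Fin S.levelDim)) (levelSet hμ β),
        IsPullbackMetric gL gM (Subtype.val : levelSet hμ β → M) ∧
        ∃ gβ : RiemannianMetricOn (EuclideanSpace ℝ (Fin S.reducedDim)) (ReducedSpace hμ β),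
          IsRiemannianSubmersion gL gβ (reducedProj hμ β) := by
  refine ⟨nonempty_reducedManifold hμ hβ hfree hproper, fun S => ?_⟩
  obtain ⟨gL, hL⟩ := exists_isPullbackMetric S.isSmoothEmbedding_incl.isImmersion gM
  exact ⟨gL, hL, exists_reducedMetric S hG hL⟩
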